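/- Let $n\ge 2$, $k\in\mathbb Z$ and $m=|nk+1|$. Identify $\mathbb Z_m$ with the subgroup $\{\sigma\cdot\mathrm{id}:\sigma^m=1\}$ of the unitary group $U_n$, let ${\cal L}^{2n-1}_m=S^{2n-1}/\mathbb Z_m$ be the lens manifold (each $x\in S^{2n-1}\subset\mathbb C^n$ is identified with $e^{2\pi i/m}x$) with the standard action of $U_n/\mathbb Z_m$ and with the smooth structure and the CR-structure inherited from $S^{2n-1}$, and let $$\phi_{n,m}:U_n/\mathbb Z_m\to U_n,\qquad \phi_{n,m}(A\mathbb Z_m)=(\det A)^k\cdot A .$$ Let $M$ be a complex manifold of dimension $n$ endowed with a (continuous) effective action of $U_n$ by biholomorphic transformations. Let $p\in M$ and suppose that the orbit $O(p)$ is a real hypersurface in $M$ that is isomorphic as a homogeneous space to ${\cal L}^{2n-1}_m$, i.e. that there are an isomorphism of Lie groups $\psi:U_n/\mathbb Z_m\to U_n$ and a diffeomorphism $f:{\cal L}^{2n-1}_m\to O(p)$ with $f(gq)=\psi(g)f(q)$ for all $g\in U_n/\mathbb Z_m$, $q\in{\cal L}^{2n-1}_m$. Then there is a CR-diffeomorphism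 ${\cal F}:{\cal L}^{2n-1}_m\to O(p)$, where $O(p)$ carries the CR-structure inherited from $M$, that satisfies either $${\cal F}(gq)=\phi_{n,m}(g)\,{\cal F}(q)\quad\text{for all } g\in U_n/\mathbb Z_m,\ q\in{\cal L}^{2n-1}_m,$$ or $${\cal F}(gq)=\phi_{n,m}(\overline g)\,{\cal F}(q)\quad\text{for all } g\in U_n/\mathbb Z_m,\ q\in{\cal L}^{2n-1}_m .$$ -/

import Mathlib

open scoped Manifold ContDiff Matrix

noncomputable section

/-! ### The unitary group, the sphere and the lens manifold -/

/-- The unitary group `U_n`. -/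
abbrev Un (n : ℕ) : Type := Matrix.unitaryGroup (Fin n) ℂ

/-- The space `ℂⁿ` with its Hermitian norm. -/
abbrev Cn (n : ℕ) : Type := EuclideanSpace ℂ (Fin n)

/-- The unit sphere `S^{2n-1}` in `ℂⁿ`. -/
abbrev UnitSphere (n : ℕ) : Type := Metric.sphere (0 : Cn n) 1

/-- The real dimension of `ℂⁿ`, in the form in which the smooth structure of the sphere needs it. -/
instance factFinrankCn (n : ℕ) [NeZero n] :
    Fact (Module.finrank ℝ (Cn n) = (2 * n - 1) + 1) := ⟨by
  have h : Module.finrank ℝ (Cn n) = 2 * n := by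
    rw [finrank_real_of_complex, finrank_euclideanSpace_fin]
  have := NeZero.pos n
  omega⟩

theorem Un.norm_mulVec {n : ℕ} (A : Un n) (x : Cn n) :
    ‖WithLp.toLp 2 ((A : Matrix (Fin n) (Fin n) ℂ) *ᵥ x.ofLp)‖ = ‖x‖ := by
  have hA : Matrix.toEuclideanCLM (n := Fin n) (𝕜 := ℂ) (A : Matrix (Fin n) (Fin n) ℂ) ∈
      unitary (Cn n →L[ℂ] Cn n) := Unitary.map_mem _ A.2
  exact ContinuousLinearMap.norm_map_of_mem_unitary hA x

/-- The standard action of `U_n` on `S^{2n-1}`, `(A, x) ↦ A x`. -/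
instance sphereAction (n : ℕ) : MulAction (Un n) (UnitSphere n) where
  smul A x := ⟨WithLp.toLp 2 ((A : Matrix (Fin n) (Fin n) ℂ) *ᵥ (x : Cn n).ofLp), by
    rw [mem_sphere_zero_iff_norm, Un.norm_mulVec]
    exact mem_sphere_zero_iff_norm.1 x.2⟩
  one_smul x := Subtype.ext (by
    change WithLp.toLp 2 ((1 : Matrix (Fin n) (Fin n) ℂ) *ᵥ (x : Cn n).ofLp) = (x : Cn n)
    rw [Matrix.one_mulVec])
  mul_smul A B x := Subtype.ext (by
    change WithLp.toLp 2 (((A : Matrix (Fin n) (Fin n) ℂ) * (B : Matrix (Fin n) (Fin n) ℂ)) *ᵥ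
        (x : Cn n).ofLp) =
      WithLp.toLp 2 ((A : Matrix (Fin n) (Fin n) ℂ) *ᵥ
        ((B : Matrix (Fin n) (Fin n) ℂ) *ᵥ (x : Cn n).ofLp))
    rw [Matrix.mulVec_mulVec])

theorem sphereAction_coe {n : ℕ} (A : Un n) (x : UnitSphere n) :
    ((A • x : UnitSphere n) : Cn n) =
      WithLp.toLp 2 ((A : Matrix (Fin n) (Fin n) ℂ) *ᵥ (x : Cn n).ofLp) := rfl

/-- The group `ℤ_m`, realized as the subgroup of `U_n` of the matrices `σ · id` with `σ ^ m = 1`. -/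
def Zm (n m : ℕ) : Subgroup (Un n) where
  carrier := {A | ∃ σ : ℂ, σ ^ m = 1 ∧ (A : Matrix (Fin n) (Fin n) ℂ) = σ • 1}
  one_mem' := ⟨1, one_pow m, by simp⟩
  mul_mem' := by
    rintro A B ⟨σ, hσ, hA⟩ ⟨τ, hτ, hB⟩
    exact ⟨σ * τ, by rw [mul_pow, hσ, hτ, one_mul], by
      rw [Submonoid.coe_mul, hA, hB, smul_mul_smul_comm, one_mul]⟩
  inv_mem' := by
    rintro A ⟨σ, hσ, hA⟩
    refine ⟨star σ, by rw [← star_pow, hσ, star_one], ?_⟩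
    change star (A : Matrix (Fin n) (Fin n) ℂ) = _
    rw [hA, star_smul, star_one]

theorem Zm.commute {n m : ℕ} {A : Un n} (hA : A ∈ Zm n m) (B : Un n) : A * B = B * A := by
  obtain ⟨σ, -, h⟩ := hA
  apply Subtype.ext
  rw [Submonoid.coe_mul, Submonoid.coe_mul, h, smul_mul_assoc, mul_smul_comm, one_mul, mul_one]

instance Zm.normal (n m : ℕ) : (Zm n m).Normal where
  conj_mem A hA B := by
    rw [← Zm.commute hA B, mul_assoc, mul_inv_cancel, mul_one]
    exact hA

instance Zm.finite (n m : ℕ) [NeZero m] : Finite (Zm n m) := by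
  have hfin : Set.Finite {σ : ℂ | σ ^ m = 1} := by
    refine Set.Finite.subset (Polynomial.nthRoots m (1 : ℂ)).toFinset.finite_toSet ?_
    intro σ hσ
    simpa [Polynomial.mem_nthRoots (NeZero.pos m)] using hσ
  have himg := hfin.image (fun σ : ℂ => σ • (1 : Matrix (Fin n) (Fin n) ℂ))
  refine Set.Finite.to_subtype (Set.Finite.of_finite_image (f := Subtype.val) ?_
    Subtype.val_injective.injOn)
  refine himg.subset ?_
  rintro _ ⟨A, ⟨σ, hσ, hA⟩, rfl⟩
  exact ⟨σ, hσ, hA.symm⟩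

instance (n : ℕ) : ContinuousConstSMul (Un n) (UnitSphere n) where
  continuous_const_smul A := by
    refine Continuous.subtype_mk ?_ _
    exact (Matrix.toEuclideanCLM (n := Fin n) (𝕜 := ℂ)
      (A : Matrix (Fin n) (Fin n) ℂ)).continuous.comp continuous_subtype_val

instance (n m : ℕ) : ContinuousConstSMul (Zm n m) (UnitSphere n) where
  continuous_const_smul A := continuous_const_smul (A : Un n)

/-- `ℤ_m` acts freely on the sphere. -/
instance Zm.isCancelSMul (n m : ℕ) : IsCancelSMul (Zm n m) (UnitSphere n) where
  left_cancel' A x y h := MulAction.injective A h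
  right_cancel' := by
    rintro ⟨A, σ, hσ, hA⟩ ⟨B, τ, hτ, hB⟩ x h
    have h' : (σ • (x : Cn n)) = τ • (x : Cn n) := by
      have h1 := congrArg (fun y : UnitSphere n => (y : Cn n).ofLp) h
      change (A : Matrix (Fin n) (Fin n) ℂ) *ᵥ (x : Cn n).ofLp =
        (B : Matrix (Fin n) (Fin n) ℂ) *ᵥ (x : Cn n).ofLp at h1
      rw [hA, hB, Matrix.smul_mulVec, Matrix.smul_mulVec, Matrix.one_mulVec] at h1
      exact congrArg (WithLp.toLp 2) h1
    have hx : (x : Cn n) ≠ 0 := ne_zero_of_mem_unit_sphere x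
    have hστ : σ = τ := smul_left_injective ℂ hx h'
    exact Subtype.ext (Subtype.ext (by rw [hA, hB, hστ]))

/-- The lens manifold `S^{2n-1}/ℤ_m`. For `m, n ≥ 1` it carries the smooth structure (a
`ChartedSpace` over `ℝ^{2n-1}`) for which the projection from the sphere is a local
diffeomorphism: this is Mathlib's structure on the quotient of a manifold by a free properly
discontinuous action. -/
abbrev Lens (n m : ℕ) : Type := MulAction.orbitRel.Quotient (Zm n m) (UnitSphere n)

/-- The covering `S^{2n-1} → S^{2n-1}/ℤ_m`. -/
abbrev Lens.mk (n m : ℕ) (x : UnitSphere n) : Lens n m := Quotient.mk _ x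

/-- The standard action of `U_n/ℤ_m` on the lens manifold, `(Aℤ_m) [x] = [A x]`. -/
instance lensAction (n m : ℕ) : MulAction (Un n ⧸ Zm n m) (Lens n m) where
  smul g y := Quotient.liftOn₂ g y (fun A x => Lens.mk n m (A • x)) (by
    intro A x B y hAB hxy
    obtain ⟨C, rfl⟩ := MulAction.orbitRel_apply.1 hxy
    have hAB' : A⁻¹ * B ∈ Zm n m := QuotientGroup.leftRel_apply.1 hAB
    refine Quotient.sound (MulAction.orbitRel_apply.2 ⟨C * ⟨A⁻¹ * B, hAB'⟩⁻¹, ?_⟩)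
    change ((C : Un n) * (A⁻¹ * B)⁻¹) • B • y = A • (C : Un n) • y
    rw [smul_smul, smul_smul, Zm.commute C.2, ← Zm.commute C.2 A, mul_inv_rev, inv_inv,
      ← Zm.commute C.2, mul_assoc]
    congr 2
    have := Zm.commute ((Zm n m).inv_mem hAB') B
    rw [mul_inv_rev, inv_inv] at this
    rw [this, mul_inv_cancel_left])
  one_smul y := by
    induction y using Quotient.inductionOn with
    | h x => exact congrArg (Lens.mk n m) (one_smul (Un n) x)
  mul_smul g h y := by
    induction g using QuotientGroup.induction_on with
    | H A =>
      induction h using QuotientGroup.induction_on with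
      | H B =>
        induction y using Quotient.inductionOn with
        | h x => exact congrArg (Lens.mk n m) (mul_smul A B x)

theorem lensAction_mk {n m : ℕ} (A : Un n) (x : UnitSphere n) :
    (A : Un n ⧸ Zm n m) • Lens.mk n m x = Lens.mk n m (A • x) := rfl

/-! ### The isomorphism `φ_{n,m}` and complex conjugation -/

/-- The homomorphism `U_n → U_n`, `A ↦ (det A)^k · A`. -/
def detTwist (n : ℕ) (k : ℤ) : Un n →* Un n where
  toFun A := ⟨(A : Matrix (Fin n) (Fin n) ℂ).det ^ k • (A : Matrix (Fin n) (Fin n) ℂ), by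
    have hd : star (A : Matrix (Fin n) (Fin n) ℂ).det * (A : Matrix (Fin n) (Fin n) ℂ).det = 1 :=
      (Unitary.mem_iff.1 (Matrix.det_of_mem_unitary A.2)).1
    rw [Matrix.mem_unitaryGroup_iff', star_smul, smul_mul_smul_comm,
      Matrix.UnitaryGroup.star_mul_self, star_zpow₀, ← mul_zpow, hd, one_zpow, one_smul]⟩
  map_one' := Subtype.ext (by simp)
  map_mul' A B := Subtype.ext (by
    simp only [Submonoid.coe_mul, Matrix.det_mul, mul_zpow, smul_mul_smul_comm])

theorem detTwist_coe {n : ℕ} (k : ℤ) (A : Un n) :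
    (detTwist n k A : Matrix (Fin n) (Fin n) ℂ) =
      (A : Matrix (Fin n) (Fin n) ℂ).det ^ k • (A : Matrix (Fin n) (Fin n) ℂ) := rfl

/-- For `m = |nk+1|`, the homomorphism
`φ_{n,m} : U_n/ℤ_m → U_n`, `φ_{n,m}(Aℤ_m) = (det A)^k · A`. -/
def lensPhi (n m : ℕ) (k : ℤ) (hm : (m : ℤ) = |(n : ℤ) * k + 1|) : Un n ⧸ Zm n m →* Un n :=
  QuotientGroup.lift (Zm n m) (detTwist n k) (by
    rintro A ⟨σ, hσ, hA⟩
    apply Subtype.ext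
    rw [detTwist_coe, hA, Matrix.det_smul, Matrix.det_one, mul_one, Fintype.card_fin, smul_smul]
    by_cases hm0 : m = 0
    · have h0 : (n : ℤ) * k = -1 := by
        have := abs_eq_zero.1 (hm.symm.trans (by rw [hm0]; rfl))
        linarith
      have hn : n = 1 := by
        have h1 : (n : ℤ) ∣ 1 := ⟨-k, by rw [mul_neg, h0, neg_neg]⟩
        exact_mod_cast Int.eq_one_of_dvd_one (by positivity) h1
      subst hn
      have hk : k = -1 := by simpa using h0
      subst hk
      have hσ0 : σ ≠ 0 := by
        rintro rfl
        have h1 := congrArg (fun B : Matrix (Fin 1) (Fin 1) ℂ => (B * star B) 0 0) hA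
        simp only [(Matrix.mem_unitaryGroup_iff.1 A.2), zero_smul, zero_mul, Matrix.one_apply_eq,
          Matrix.zero_apply] at h1
        exact one_ne_zero h1
      rw [pow_one, zpow_neg_one, inv_mul_cancel₀ hσ0, one_smul]
      rfl
    · have hσ0 : σ ≠ 0 := by
        rintro rfl
        rw [zero_pow hm0] at hσ
        exact zero_ne_one hσ
      have hd : (m : ℤ) ∣ (n : ℤ) * k + 1 := by
        rw [hm]
        exact (abs_dvd _ _).2 dvd_rfl
      obtain ⟨c, hc⟩ := hd
      have : (σ ^ n) ^ k * σ = 1 := by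
        rw [← zpow_natCast σ n, ← zpow_mul, ← zpow_add_one₀ hσ0, hc, zpow_mul, zpow_natCast, hσ,
          one_zpow]
      rw [this, one_smul]
      rfl)

theorem lensPhi_mk {n m : ℕ} (k : ℤ) (hm : (m : ℤ) = |(n : ℤ) * k + 1|) (A : Un n) :
    (lensPhi n m k hm (A : Un n ⧸ Zm n m) : Matrix (Fin n) (Fin n) ℂ) =
      (A : Matrix (Fin n) (Fin n) ℂ).det ^ k • (A : Matrix (Fin n) (Fin n) ℂ) := rfl

/-- Entrywise complex conjugation on `U_n`. -/
def conjUn (n : ℕ) : Un n →* Un n where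
  toFun A := Matrix.UnitaryGroup.map_star A
  map_one' := Subtype.ext (by
    change (1 : Matrix (Fin n) (Fin n) ℂ).map star = 1
    exact Matrix.map_one star (star_zero _) (star_one _))
  map_mul' A B := Subtype.ext (by
    change ((A : Matrix (Fin n) (Fin n) ℂ) * (B : Matrix (Fin n) (Fin n) ℂ)).map (starRingEnd ℂ) =
      (A : Matrix (Fin n) (Fin n) ℂ).map (starRingEnd ℂ) *
        (B : Matrix (Fin n) (Fin n) ℂ).map (starRingEnd ℂ)
    exact Matrix.map_mul)

/-- Complex conjugation on `U_n/ℤ_m`, `Aℤ_m ↦ Āℤ_m`. -/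
def conjQuot (n m : ℕ) : Un n ⧸ Zm n m →* Un n ⧸ Zm n m :=
  QuotientGroup.map (Zm n m) (Zm n m) (conjUn n) (by
    rintro A ⟨σ, hσ, hA⟩
    refine ⟨star σ, by rw [← star_pow, hσ, star_one], ?_⟩
    change (A : Matrix (Fin n) (Fin n) ℂ).map star = _
    rw [hA]
    ext i j
    by_cases hij : i = j <;> simp [hij])

/-! ### Submanifolds of a complex manifold and CR-structures

A complex manifold `M` of dimension `n` is a space with a holomorphic atlas modelled on `ℂⁿ`. The
same atlas makes it a real manifold, with model `𝓘(ℝ, ℂⁿ)`. The tangent space at `x`, identified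
with `ℂⁿ` through the preferred (holomorphic) chart at `x`, is a complex vector space.
A CR-structure, that is, a subbundle `H` of the tangent bundle with a complex structure `J` on its
fibres, is recorded through the graph of `J`: the relation "`v ∈ H` and `w = J v`" between
tangent vectors `v`, `w` at the same point. -/

section Manifolds

variable {n : ℕ} {M : Type*} [TopologicalSpace M] [ChartedSpace (Cn n) M]

/-- `S` is a (smooth, embedded) real hypersurface of `M`: near each of its points it is the zero
set of a smooth real function with non-vanishing differential. -/
def IsRealHypersurface (n : ℕ) {M : Type*} [TopologicalSpace M] [ChartedSpace (Cn n) M]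
    (S : Set M) : Prop :=
  ∀ y ∈ S, ∃ U : Set M, IsOpen U ∧ y ∈ U ∧ ∃ ρ : M → ℝ,
    ContMDiffOn 𝓘(ℝ, Cn n) 𝓘(ℝ, ℝ) ∞ ρ U ∧
    ∀ x ∈ U, (x ∈ S ↔ ρ x = 0) ∧ mfderiv 𝓘(ℝ, Cn n) 𝓘(ℝ, ℝ) ρ x ≠ 0

/-- The tangent space at `y` of a smooth submanifold `S` of `M`: the set of velocity vectors at `y`
of the smooth curves that lie in `S`. -/
def tangentTo (S : Set M) (y : M) : Set (TangentSpace 𝓘(ℝ, Cn n) y) :=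
  {v | ∃ γ : ℝ → M, ContMDiff 𝓘(ℝ, ℝ) 𝓘(ℝ, Cn n) ∞ γ ∧ (∀ t, γ t ∈ S) ∧ γ 0 = y ∧
    (mfderiv 𝓘(ℝ, ℝ) 𝓘(ℝ, Cn n) γ 0 (1 : ℝ) : Cn n) = v}

/-- Multiplication by `i` on the tangent space of a complex manifold. -/
def tangentI (y : M) : TangentSpace 𝓘(ℝ, Cn n) y → TangentSpace 𝓘(ℝ, Cn n) y :=
  fun v : Cn n => Complex.I • v

/-- The CR-structure that a real submanifold `S` of `M` inherits from `M`: `H_y` is the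
maximal complex subspace `T_y S ∩ i T_y S` of `T_y M` that is tangent to `S`, and `J` is the
multiplication by `i`. -/
def inheritedCR (S : Set M) (y : M) (v w : TangentSpace 𝓘(ℝ, Cn n) y) : Prop :=
  v ∈ tangentTo S y ∧ w ∈ tangentTo S y ∧ w = tangentI y v

/-- The standard CR-structure of `S^{2n-1} ⊂ ℂⁿ`: `v ∈ H_q` and `w = J v` if and only if
the tangent vectors `v`, `w` of the sphere, regarded as vectors in `ℂⁿ`, satisfy `w = i v`. -/
def sphereCR [NeZero n] (q : UnitSphere n) (v w : TangentSpace (𝓡 (2 * n - 1)) q) : Prop :=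
  mvfderiv (𝓡 (2 * n - 1)) (Subtype.val : UnitSphere n → Cn n) q w =
    Complex.I • mvfderiv (𝓡 (2 * n - 1)) (Subtype.val : UnitSphere n → Cn n) q v

/-- The CR-structure of the lens manifold: the image of the standard one of `S^{2n-1}` under the
covering `S^{2n-1} → S^{2n-1}/ℤ_m`. -/
def lensCR {m : ℕ} [NeZero n] [NeZero m] (x : Lens n m)
    (v w : TangentSpace (𝓡 (2 * n - 1)) x) : Prop :=
  ∃ (q : UnitSphere n) (v' w' : TangentSpace (𝓡 (2 * n - 1)) q), Lens.mk n m q = x ∧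
    sphereCR q v' w' ∧
    (mfderiv (𝓡 (2 * n - 1)) (𝓡 (2 * n - 1)) (Lens.mk n m) q v' :
      EuclideanSpace ℝ (Fin (2 * n - 1))) = v ∧
    (mfderiv (𝓡 (2 * n - 1)) (𝓡 (2 * n - 1)) (Lens.mk n m) q w' :
      EuclideanSpace ℝ (Fin (2 * n - 1))) = w

/-- `F` is a diffeomorphism of the lens manifold onto the submanifold `S` of `M`. -/
def IsDiffeoOnto {m : ℕ} [NeZero n] [NeZero m] (F : Lens n m → M) (S : Set M) : Prop :=
  ContMDiff (𝓡 (2 * n - 1)) 𝓘(ℝ, Cn n) ∞ F ∧ Set.range F = S ∧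
    ∃ G : M → Lens n m, ContMDiffOn 𝓘(ℝ, Cn n) (𝓡 (2 * n - 1)) ∞ G S ∧ ∀ x, G (F x) = x

/-- `F` is a CR-diffeomorphism of the lens manifold onto the submanifold `S` of `M`: a
diffeomorphism whose differential carries the CR-structure of the lens manifold exactly to the
CR-structure that `S` inherits from `M`. -/
def IsCRDiffeoOnto {m : ℕ} [NeZero n] [NeZero m] (F : Lens n m → M) (S : Set M) : Prop :=
  IsDiffeoOnto F S ∧ ∀ (x : Lens n m) (v w : TangentSpace (𝓡 (2 * n - 1)) x),
    lensCR x v w ↔ inheritedCR S (F x)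
      (mfderiv (𝓡 (2 * n - 1)) 𝓘(ℝ, Cn n) F x v) (mfderiv (𝓡 (2 * n - 1)) 𝓘(ℝ, Cn n) F x w)

/-- A subset `S` of `M` that is invariant under an action of `U_n` is isomorphic as a homogeneous
space to the lens manifold with the standard action of `U_n/ℤ_m`: there are an isomorphism
`ψ : U_n/ℤ_m → U_n` of Lie groups (a continuous isomorphism is automatically one) and a
`ψ`-equivariant diffeomorphism of the lens manifold onto `S`. -/
def IsLensHomogeneous (n m : ℕ) [NeZero n] [NeZero m] {M : Type*} [TopologicalSpace M]
    [ChartedSpace (Cn n) M] [MulAction (Un n) M] (S : Set M) : Prop :=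
  ∃ (ψ : (Un n ⧸ Zm n m) ≃ₜ* Un n) (f : Lens n m → M),
    IsDiffeoOnto f S ∧ ∀ (g : Un n ⧸ Zm n m) (q : Lens n m), f (g • q) = ψ g • f q

end Manifolds

end

/-!
Two independent facts combine.

*Equivariance determines the CR-structure up to conjugation.* Let `F` be a diffeomorphism of the
lens manifold onto a subset of `M` that intertwines each `A ∈ U_n` with some holomorphic map of
`M`. Extend `F` radially to `ℂⁿ ∖ {0}`; its differential `D` at a point `q` of the sphere satisfies
`D (A u) = T_A (D u)` with `T_A` complex-linear for every unitary `A` that fixes `q`. Applied to the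
reflection in the line of `q`, this shows that the maximal complex subspace of the image of `D` is
the image of the complex orthogonal complement of `q`. Its complex structure `J`, transported to
that complement, commutes with the stabilizer of `q`: the reflections in the planes spanned by `q`
and `u` make every `u` an eigenvector, the rotation by `i` around `q` makes `J` complex-linear, and
`J² = -1` leaves `J = i` or `J = -i`, the same sign everywhere by transitivity. In the first case
`F` is CR, in the second case its composition with complex conjugation is
(`isCRDiffeoOnto_or_comp_conj`).

*The isomorphism is standard up to an inner automorphism and conjugation.* An isomorphism
`U_n/ℤ_m → U_n` is a continuous representation `r` of `U_n` on `ℂⁿ` with kernel `ℤ_m`. Its `n`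
weights on the diagonal torus are permuted by the permutations of the coordinates and are linearly
independent, because the kernel is finite. A count of the orbit of one weight leaves only the weights
`a (1, …, 1) + b e_i` (`exists_weights_form`), and the kernel being `ℤ_m` forces `b = ±1` and
`|n a + b| = m` (`weights_of_ker_eq_Zm`). So `r` has the character of `A ↦ (det A)^k A` or of its
composition with conjugation. Averaging over Haar measure yields an intertwiner, unitary up to
scaling since `r` is onto (`exists_conj_of_trace_eq`); hence `r` is conjugate to one of the two
(`exists_conj_detTwist`).

Translating the given diffeomorphism by the conjugating element makes it equivariant for `φ_{n,m}` or
for its composition with conjugation, and the possible composition with conjugation that makes it CR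
interchanges these two alternatives.
-/

open scoped Manifold ContDiff Matrix

noncomputable section

set_option linter.unusedSectionVars false

/-! ### The smooth structure of the lens manifold -/

theorem Lens.mk_smul {n m : ℕ} (A : Zm n m) (q : UnitSphere n) :
    Lens.mk n m ((A : Un n) • q) = Lens.mk n m q :=
  Quotient.sound (MulAction.orbitRel_apply.2 ⟨A, rfl⟩)

theorem Lens.mk_eq_iff {n m : ℕ} (q q' : UnitSphere n) :
    Lens.mk n m q = Lens.mk n m q' ↔ ∃ A : Zm n m, (A : Un n) • q' = q := by
  rw [Quotient.eq, MulAction.orbitRel_apply]; rfl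

/-- A map to the sphere is smooth at a point if it is so as a map to the ambient space: the
pointwise version of `ContMDiff.codRestrict_sphere`. -/
theorem ContMDiffAt.codRestrict_sphere {E : Type*} [NormedAddCommGroup E] [InnerProductSpace ℝ E]
    {m : ℕ∞ω} {F : Type*} [NormedAddCommGroup F] [NormedSpace ℝ F]
    {H : Type*} [TopologicalSpace H] {I : ModelWithCorners ℝ F H}
    {M : Type*} [TopologicalSpace M] [ChartedSpace H M]
    {n : ℕ} [Fact (Module.finrank ℝ E = n + 1)] {f : M → Metric.sphere (0 : E) 1} {x : M}
    (hf : ContMDiffAt I 𝓘(ℝ, E) m (fun y => (f y : E)) x) :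
    ContMDiffAt I (𝓡 n) m f x := by
  rw [contMDiffAt_iff_target]
  refine ⟨Topology.IsInducing.subtypeVal.continuousAt_iff.2 hf.continuousAt, ?_⟩
  set v := f x
  let U : _ ≃ₗᵢ[ℝ] _ :=
    (OrthonormalBasis.fromOrthogonalSpanSingleton (𝕜 := ℝ)
        n (ne_zero_of_mem_unit_sphere (-v))).repr
  have hs : ContDiffAt ℝ ω (U ∘ stereoToFun (-v : E)) (v : E) := by
    refine U.contDiff.contDiffAt.comp _ ?_
    refine (contDiffOn_stereoToFun (v := (-v : E))).contDiffAt (IsOpen.mem_nhds ?_ ?_)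
    · exact isOpen_ne_fun (by fun_prop) continuous_const
    · have : ‖(v : E)‖ = 1 := norm_eq_of_mem_sphere v
      simp only [Set.mem_ofPred_eq, innerSL_apply_apply, inner_neg_left,
        real_inner_self_eq_norm_sq, this]
      norm_num
  have := (hs.contMDiffAt.of_le le_top : ContMDiffAt 𝓘(ℝ, E) _ m _ _).comp x hf
  exact this

theorem UnitSphere.contMDiff_of_coe {n : ℕ} [NeZero n] {f : UnitSphere n → UnitSphere n}
    (hf : ContMDiff (𝓡 (2 * n - 1)) 𝓘(ℝ, Cn n) ∞ (fun y => (f y : Cn n))) :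
    ContMDiff (𝓡 (2 * n - 1)) (𝓡 (2 * n - 1)) ∞ f :=
  fun x => (hf x).codRestrict_sphere

theorem UnitSphere.contMDiff_smul {n : ℕ} [NeZero n] (A : Un n) :
    ContMDiff (𝓡 (2 * n - 1)) (𝓡 (2 * n - 1)) ∞ (fun y : UnitSphere n => A • y) := by
  apply UnitSphere.contMDiff_of_coe
  have h : ContMDiff 𝓘(ℝ, Cn n) 𝓘(ℝ, Cn n) ∞
      (fun z => (Matrix.toEuclideanCLM (n := Fin n) (𝕜 := ℂ)
      (A : Matrix (Fin n) (Fin n) ℂ)).restrictScalars ℝ z) :=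
    (ContinuousLinearMap.contDiff _).contMDiff
  exact h.comp (contMDiff_coe_sphere)

/-- The preferred chart at a point of the lens manifold is a local inverse of the covering followed by
the preferred chart of the sphere. -/
theorem Lens.exists_chart {n m : ℕ} [NeZero n] [NeZero m] (x : Lens n m) :
    ∃ (s : OpenPartialHomeomorph (Lens n m) (UnitSphere n)),
      x ∈ s.source ∧ (∀ y, s.symm y = Lens.mk n m y) ∧
      chartAt (EuclideanSpace ℝ (Fin (2 * n - 1))) x =
        s ≫ₕ chartAt (EuclideanSpace ℝ (Fin (2 * n - 1))) (s x) := by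
  have hl : IsLocalHomeomorph (Lens.mk n m) :=
    isQuotientCoveringMap_quotientMk_of_properlyDiscontinuousSMul.isCoveringMap.isLocalHomeomorph
  have hsurj : Function.Surjective (Lens.mk n m) := Quotient.mk_surjective
  let q := hsurj.hasRightInverse.choose x
  have hq : Lens.mk n m q = x := hsurj.hasRightInverse.choose_spec x
  refine ⟨hl.localInverseAt q, ?_, fun y => ?_, ?_⟩
  · have := hl.apply_self_mem_localInverseAt_source (x := q)
    rwa [hq] at this
  · rw [hl.localInverseAt_symm]
  · have : (hl.localInverseAt q) x = q := by
      have := hl.localInverseAt_apply_self (x := q)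
      rwa [hq] at this
    rw [this]; rfl

/-- The covering has a local section through a point at which both are smooth. -/
theorem Lens.exists_section {n m : ℕ} [NeZero n] [NeZero m] (x : Lens n m) :
    ∃ s : Lens n m → UnitSphere n, (∀ᶠ y in nhds x, Lens.mk n m (s y) = y) ∧
      ContMDiffAt (𝓡 (2 * n - 1)) (𝓡 (2 * n - 1)) ∞ s x ∧
      ContMDiffAt (𝓡 (2 * n - 1)) (𝓡 (2 * n - 1)) ∞ (Lens.mk n m) (s x) := by
  obtain ⟨s, hx, hs, hc⟩ := Lens.exists_chart x
  have hmk : Lens.mk n m = s.symm := funext fun y => (hs y).symm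
  have hsx : Lens.mk n m (s x) = x := by rw [hmk, s.left_inv hx]
  have hext : (extChartAt (𝓡 (2 * n - 1)) x : Lens n m → _) =
      extChartAt (𝓡 (2 * n - 1)) (s x) ∘ s := by
    rw [extChartAt, hc]; rfl
  refine ⟨s, ?_, ?_, ?_⟩
  · filter_upwards [s.open_source.mem_nhds hx] with y hy
    rw [hmk, s.left_inv hy]
  · rw [contMDiffAt_iff_target]
    refine ⟨s.continuousAt hx, ?_⟩
    rw [← hext]
    exact contMDiffAt_extChartAt
  · rw [contMDiffAt_iff_target, hsx, hext, hmk]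
    refine ⟨s.symm.continuousAt (s.map_source hx), ?_⟩
    refine (contMDiffAt_extChartAt (I := 𝓡 (2 * n - 1)) (x := s x)).congr_of_eventuallyEq ?_
    filter_upwards [s.open_target.mem_nhds (s.map_source hx)] with y hy
    simp only [Function.comp_apply, s.right_inv hy]

theorem Lens.contMDiff_mk (n m : ℕ) [NeZero n] [NeZero m] :
    ContMDiff (𝓡 (2 * n - 1)) (𝓡 (2 * n - 1)) ∞ (Lens.mk n m) := by
  intro q
  obtain ⟨s, hs, -, h⟩ := Lens.exists_section (Lens.mk n m q)
  obtain ⟨A, hA⟩ := (Lens.mk_eq_iff _ _).1 hs.self_of_nhds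
  have he : Lens.mk n m = Lens.mk n m ∘ fun y => (A : Un n) • y :=
    funext fun y => (Lens.mk_smul A y).symm
  rw [← hA] at h
  rw [he]
  exact ContMDiffAt.comp q h (UnitSphere.contMDiff_smul (A : Un n) q)

/-- Smoothness on the lens manifold can be tested on the sphere. -/
theorem Lens.contMDiff_of_comp_mk {n m : ℕ} [NeZero n] [NeZero m]
    {F : Type*} [NormedAddCommGroup F] [NormedSpace ℝ F]
    {H : Type*} [TopologicalSpace H] {I : ModelWithCorners ℝ F H}
    {N : Type*} [TopologicalSpace N] [ChartedSpace H N] {f : Lens n m → N}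
    (hf : ContMDiff (𝓡 (2 * n - 1)) I ∞ (f ∘ Lens.mk n m)) :
    ContMDiff (𝓡 (2 * n - 1)) I ∞ f := by
  intro x
  obtain ⟨s, hs, h, -⟩ := Lens.exists_section x
  refine (ContMDiffAt.comp x (hf (s x)) h).congr_of_eventuallyEq ?_
  filter_upwards [hs] with y hy
  simp only [Function.comp_apply, hy]

/-- Above each point of the lens manifold there is a point of the sphere to which all tangent vectors
lift. -/
theorem Lens.exists_surjective_mfderiv_mk {n m : ℕ} [NeZero n] [NeZero m] (x : Lens n m) :
    ∃ q : UnitSphere n, Lens.mk n m q = x ∧ ∀ v : TangentSpace (𝓡 (2 * n - 1)) x,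
      ∃ v' : TangentSpace (𝓡 (2 * n - 1)) q,
      (mfderiv (𝓡 (2 * n - 1)) (𝓡 (2 * n - 1)) (Lens.mk n m) q v' :
        EuclideanSpace ℝ (Fin (2 * n - 1))) = v := by
  obtain ⟨s, hs, h, h'⟩ := Lens.exists_section x
  refine ⟨s x, hs.self_of_nhds, fun v => ⟨mfderiv (𝓡 (2 * n - 1)) (𝓡 (2 * n - 1)) s x v, ?_⟩⟩
  have h1 := mfderiv_comp x (h'.mdifferentiableAt (by simp)) (h.mdifferentiableAt (by simp))
  have h2 : mfderiv (𝓡 (2 * n - 1)) (𝓡 (2 * n - 1)) (Lens.mk n m ∘ s) x =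
      mfderiv (𝓡 (2 * n - 1)) (𝓡 (2 * n - 1)) id x := Filter.EventuallyEq.mfderiv_eq hs
  rw [mfderiv_id] at h2
  have h3 := h1.symm.trans h2
  exact DFunLike.congr_fun h3 v

/-! ### Extension of a map of the lens manifold to `ℂⁿ ∖ {0}` and its differential -/

/-- The radial projection `z ↦ z / ‖z‖` of `ℂⁿ ∖ {0}` onto the sphere, with an arbitrary value
at `0`. -/
def unitVec {n : ℕ} [NeZero n] (z : Cn n) : UnitSphere n :=
  if h : z = 0 then ⟨EuclideanSpace.single 0 1, by simp⟩
  else ⟨‖z‖⁻¹ • z, by simp [norm_smul, h]⟩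

theorem unitVec_coe {n : ℕ} [NeZero n] {z : Cn n} (h : z ≠ 0) :
    (unitVec z : Cn n) = ‖z‖⁻¹ • z := by simp [unitVec, h]

@[simp] theorem unitVec_of_mem {n : ℕ} [NeZero n] (q : UnitSphere n) : unitVec (q : Cn n) = q := by
  have h : ‖(q : Cn n)‖ = 1 := norm_eq_of_mem_sphere q
  apply Subtype.ext
  rw [unitVec_coe (ne_zero_of_mem_unit_sphere q), h, inv_one, one_smul]

theorem contMDiffAt_unitVec {n : ℕ} [NeZero n] {z : Cn n} (h : z ≠ 0) :
    ContMDiffAt 𝓘(ℝ, Cn n) (𝓡 (2 * n - 1)) ∞ unitVec z := by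
  apply ContMDiffAt.codRestrict_sphere
  have : ContDiffAt ℝ ∞ (fun z : Cn n => ‖z‖⁻¹ • z) z :=
    ((contDiffAt_norm ℝ h).inv (norm_ne_zero_iff.2 h)).smul contDiffAt_id
  refine this.contMDiffAt.congr_of_eventuallyEq ?_
  filter_upwards [isOpen_ne.mem_nhds h] with y hy
  exact unitVec_coe hy

/-- The complex-linear map of `ℂⁿ` given by a unitary matrix. -/
def Un.toCLM {n : ℕ} (A : Un n) : Cn n →L[ℂ] Cn n :=
  Matrix.toEuclideanCLM (n := Fin n) (𝕜 := ℂ) (A : Matrix (Fin n) (Fin n) ℂ)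

theorem Un.coe_smul {n : ℕ} (A : Un n) (q : UnitSphere n) :
    ((A • q : UnitSphere n) : Cn n) = A.toCLM q := rfl

theorem Un.norm_toCLM {n : ℕ} (A : Un n) (z : Cn n) : ‖A.toCLM z‖ = ‖z‖ := Un.norm_mulVec A z

theorem unitVec_toCLM {n : ℕ} [NeZero n] (A : Un n) {z : Cn n} (h : z ≠ 0) :
    unitVec (A.toCLM z) = A • unitVec z := by
  have h' : A.toCLM z ≠ 0 := by rw [← norm_ne_zero_iff, Un.norm_toCLM]; simpa
  apply Subtype.ext
  rw [unitVec_coe h', Un.coe_smul, unitVec_coe h, Un.norm_toCLM]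
  simp [← Complex.coe_smul]

section Cone

variable {n m : ℕ} [NeZero n] [NeZero m] {M : Type*} [TopologicalSpace M] [ChartedSpace (Cn n) M]

/-- The radial extension `z ↦ F [z / ‖z‖]` of a map of the lens manifold to `ℂⁿ ∖ {0}`. Its
differential at a point of the sphere is a map between copies of `ℂⁿ`, which frees the arguments from
the charts of the sphere and of the lens manifold. -/
def coneLift (F : Lens n m → M) (z : Cn n) : M := F (Lens.mk n m (unitVec z))

theorem coneLift_coe (F : Lens n m → M) (q : UnitSphere n) :
    coneLift F (q : Cn n) = F (Lens.mk n m q) := by simp [coneLift]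

theorem contMDiffAt_coneLift {F : Lens n m → M}
    (hF : ContMDiff (𝓡 (2 * n - 1)) 𝓘(ℝ, Cn n) ∞ F) {z : Cn n} (hz : z ≠ 0) :
    ContMDiffAt 𝓘(ℝ, Cn n) 𝓘(ℝ, Cn n) ∞ (coneLift F) z :=
  ContMDiffAt.comp (g := F ∘ Lens.mk n m) z ((hF.comp (Lens.contMDiff_mk n m)) _)
    (contMDiffAt_unitVec hz)

/-- The differential of `coneLift F` at `z`, where the tangent space of `M` at the image is identified
with `ℂⁿ` through the preferred chart. -/
def coneDeriv (F : Lens n m → M) (z : Cn n) : Cn n →L[ℝ] Cn n :=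
  mfderiv 𝓘(ℝ, Cn n) 𝓘(ℝ, Cn n) (coneLift F) z

theorem coneDeriv_mvfderiv_val {F : Lens n m → M}
    (hF : ContMDiff (𝓡 (2 * n - 1)) 𝓘(ℝ, Cn n) ∞ F) (q : UnitSphere n)
    (v : TangentSpace (𝓡 (2 * n - 1)) q) :
    coneDeriv F q (mvfderiv (𝓡 (2 * n - 1)) (Subtype.val : UnitSphere n → Cn n) q v) =
      (mfderiv (𝓡 (2 * n - 1)) 𝓘(ℝ, Cn n) F (Lens.mk n m q)
        (mfderiv (𝓡 (2 * n - 1)) (𝓡 (2 * n - 1)) (Lens.mk n m) q v) : Cn n) := by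
  have h1 := mfderiv_comp q ((hF (Lens.mk n m q)).mdifferentiableAt (by simp))
    ((Lens.contMDiff_mk n m q).mdifferentiableAt (by simp))
  have h2 := mfderiv_comp q
    ((contMDiffAt_coneLift hF (ne_zero_of_mem_unit_sphere q)).mdifferentiableAt (by simp))
    ((contMDiff_coe_sphere (E := Cn n) (m := ∞) (n := 2 * n - 1) q).mdifferentiableAt (by simp))
  have h3 : coneLift F ∘ (Subtype.val : UnitSphere n → Cn n) = F ∘ Lens.mk n m :=
    funext (coneLift_coe F)
  rw [h3] at h2
  exact DFunLike.congr_fun (h2.symm.trans h1) v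

theorem exists_mvfderiv_val_eq {q : UnitSphere n} {u : Cn n} (hu : inner ℝ (q : Cn n) u = 0) :
    ∃ v : TangentSpace (𝓡 (2 * n - 1)) q,
      mvfderiv (𝓡 (2 * n - 1)) (Subtype.val : UnitSphere n → Cn n) q v = u := by
  have h := range_mvfderiv_subtypeVal (E := Cn n) (n := 2 * n - 1) q
  have : u ∈ (mvfderiv (𝓡 (2 * n - 1)) (Subtype.val : UnitSphere n → Cn n) q).range := by
    rw [h]; exact Submodule.mem_orthogonal_singleton_iff_inner_right.2 hu
  exact this

theorem inner_mvfderiv_val (q : UnitSphere n) (v : TangentSpace (𝓡 (2 * n - 1)) q) :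
    inner ℝ (q : Cn n) (mvfderiv (𝓡 (2 * n - 1)) (Subtype.val : UnitSphere n → Cn n) q v) = 0 := by
  have h := range_mvfderiv_subtypeVal (E := Cn n) (n := 2 * n - 1) q
  refine Submodule.mem_orthogonal_singleton_iff_inner_right.1 ?_
  rw [← h]; exact ⟨v, rfl⟩

theorem mfderiv_injective_of_isDiffeoOnto {F : Lens n m → M} {S : Set M} (hF : IsDiffeoOnto F S)
    (x : Lens n m) : Function.Injective (mfderiv (𝓡 (2 * n - 1)) 𝓘(ℝ, Cn n) F x) := by
  obtain ⟨hs, hr, G, hG, hGF⟩ := hF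
  have hFx : F x ∈ S := hr ▸ Set.mem_range_self x
  have h1 := ((hG (F x) hFx).mdifferentiableWithinAt (by simp)).hasMFDerivWithinAt
  have h2 := ((hs x).mdifferentiableAt (by simp)).hasMFDerivAt
  have h3 := hasMFDerivWithinAt_univ.1 (h1.comp x (hasMFDerivWithinAt_univ.2 h2)
    fun y _ => hr ▸ Set.mem_range_self y)
  have h4 : G ∘ F = id := funext hGF
  rw [h4] at h3
  have h5 := hasMFDerivAt_unique h3 (hasMFDerivAt_id x)
  intro v w hvw
  have e := fun v => DFunLike.congr_fun h5 v
  have := congrArg (mfderivWithin 𝓘(ℝ, Cn n) (𝓡 (2 * n - 1)) G S (F x)) hvw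
  exact (e v).symm.trans (this.trans (e w))

theorem mem_tangentTo_of_inner_eq_zero {F : Lens n m → M} {S : Set M} (hF : IsDiffeoOnto F S)
    (q : UnitSphere n) {u : Cn n} (hu : inner ℝ (q : Cn n) u = 0) :
    coneDeriv F q u ∈ tangentTo S (coneLift F (q : Cn n)) := by
  have hne : ∀ t : ℝ, (q : Cn n) + t • u ≠ 0 := by
    intro t h
    have : inner ℝ (q : Cn n) ((q : Cn n) + t • u) = 1 := by
      rw [inner_add_right, inner_smul_right, hu, real_inner_self_eq_norm_sq,
        norm_eq_of_mem_sphere]; simp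
    rw [h] at this; simp at this
  have hc : ContMDiff 𝓘(ℝ, ℝ) 𝓘(ℝ, Cn n) ∞ (fun t : ℝ => (q : Cn n) + t • u) :=
    (contDiff_const.add (contDiff_id.smul contDiff_const)).contMDiff
  have h0 : (fun t : ℝ => (q : Cn n) + t • u) 0 = q := by simp
  refine ⟨fun t => coneLift F ((q : Cn n) + t • u),
    fun t => ContMDiffAt.comp (g := coneLift F) t (contMDiffAt_coneLift hF.1 (hne t)) (hc t),
    fun t => hF.2.1 ▸ Set.mem_range_self _, by simp, ?_⟩
  have hd : HasMFDerivAt 𝓘(ℝ, ℝ) 𝓘(ℝ, Cn n) (fun t : ℝ => (q : Cn n) + t • u) 0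
      (ContinuousLinearMap.toSpanSingleton ℝ u) := by
    refine HasFDerivAt.hasMFDerivAt ?_
    exact ((hasDerivAt_id (0:ℝ)).smul_const u |>.const_add (q : Cn n)).hasFDerivAt.congr_fderiv
      (by simp; rfl)
  have h1 := ((contMDiffAt_coneLift hF.1 (hne 0)).mdifferentiableAt (by simp)).hasMFDerivAt
  have h2 := (h1.comp 0 hd).mfderiv
  have h3 := DFunLike.congr_fun h2 (1 : ℝ)
  refine Eq.trans h3 ?_
  change (mfderiv 𝓘(ℝ, Cn n) 𝓘(ℝ, Cn n) (coneLift F) ((q : Cn n) + (0:ℝ) • u) : Cn n →L[ℝ] Cn n)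
    ((1:ℝ) • u) = coneDeriv F q u
  rw [one_smul]
  change coneDeriv F ((q : Cn n) + (0:ℝ) • u) u = _
  simp

end Cone

/-! ### Unitary maps that fix a point of the sphere, and the equivariant differential -/

section Equivariance

variable {n m : ℕ} [NeZero n] [NeZero m] {M : Type*} [TopologicalSpace M] [ChartedSpace (Cn n) M]

theorem ContMDiff.restrictScalars_real {g : M → M}
    (hg : ContMDiff 𝓘(ℂ, Cn n) 𝓘(ℂ, Cn n) ω g) : ContMDiff 𝓘(ℝ, Cn n) 𝓘(ℝ, Cn n) ∞ g := by
  intro y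
  obtain ⟨h1, h2⟩ := contMDiffAt_iff.1 (hg y)
  refine contMDiffAt_iff.2 ⟨h1, ?_⟩
  have h3 := (h2.restrict_scalars ℝ).of_le (m := ∞) le_top
  exact h3

theorem HasMFDerivAt.restrictScalars_real {g : M → M} {y : M} {L : Cn n →L[ℂ] Cn n}
    (h : HasMFDerivAt 𝓘(ℂ, Cn n) 𝓘(ℂ, Cn n) g y L) :
    HasMFDerivAt 𝓘(ℝ, Cn n) 𝓘(ℝ, Cn n) g y (L.restrictScalars ℝ) :=
  ⟨h.1, HasFDerivWithinAt.restrictScalars ℝ h.2⟩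

/-- If `F` intertwines `A` with a holomorphic map `g`, then the differentials at `q` and `A q` are
related by the differential of `g`, which is complex-linear. -/
theorem coneDeriv_equivariant {F : Lens n m → M}
    (hF : ContMDiff (𝓡 (2 * n - 1)) 𝓘(ℝ, Cn n) ∞ F) {g : M → M}
    (hg : ContMDiff 𝓘(ℂ, Cn n) 𝓘(ℂ, Cn n) ω g) (A : Un n)
    (h : ∀ q : UnitSphere n, F (Lens.mk n m (A • q)) = g (F (Lens.mk n m q)))
    (q : UnitSphere n) :
    ∃ T : Cn n →L[ℂ] Cn n, ∀ u, coneDeriv F (A.toCLM q) (A.toCLM u) = T (coneDeriv F q u) := by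
  have hq := ne_zero_of_mem_unit_sphere q
  have hAq : A.toCLM (q : Cn n) ≠ 0 := ne_zero_of_mem_unit_sphere (A • q)
  have hg' := ((hg (coneLift F q)).mdifferentiableAt (by simp)).hasMFDerivAt.restrictScalars_real
  have h1 := hg'.comp _ ((contMDiffAt_coneLift hF hq).mdifferentiableAt (by simp)).hasMFDerivAt
  have hA : HasMFDerivAt 𝓘(ℝ, Cn n) 𝓘(ℝ, Cn n) A.toCLM (q : Cn n) (A.toCLM.restrictScalars ℝ) :=
    (A.toCLM.restrictScalars ℝ).hasFDerivAt.hasMFDerivAt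
  have h2 := (((contMDiffAt_coneLift hF hAq).mdifferentiableAt (by simp)).hasMFDerivAt).comp _ hA
  have he : g ∘ coneLift F =ᶠ[nhds (q : Cn n)] coneLift F ∘ A.toCLM := by
    filter_upwards [isOpen_ne.mem_nhds hq] with z hz
    simp only [Function.comp_apply, coneLift, unitVec_toCLM A hz, h]
  have h3 := hasMFDerivAt_unique h2 (h1.congr_of_eventuallyEq he.symm)
  exact ⟨mfderiv 𝓘(ℂ, Cn n) 𝓘(ℂ, Cn n) g (coneLift F q), fun u => DFunLike.congr_fun h3 u⟩

end Equivariance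

theorem inner_real_eq {n : ℕ} (u v : Cn n) : inner ℝ u v = (inner ℂ u v).re := by
  simp [PiLp.inner_apply, Complex.inner]

theorem exists_Un_toCLM_eq {n : ℕ} (A : Cn n ≃ₗᵢ[ℂ] Cn n) : ∃ B : Un n, ∀ u, B.toCLM u = A u := by
  refine ⟨⟨(Matrix.toEuclideanCLM (n := Fin n) (𝕜 := ℂ)).symm
    (Unitary.linearIsometryEquiv.symm A : Cn n →L[ℂ] Cn n), ?_⟩, fun u => ?_⟩
  · exact Unitary.map_mem (Matrix.toEuclideanCLM (n := Fin n) (𝕜 := ℂ)).symm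
      (Unitary.linearIsometryEquiv.symm A).2
  · simp [Un.toCLM]

theorem UnitSphere.exists_smul_eq {n : ℕ} (p q : UnitSphere n) : ∃ B : Un n, B • p = q := by
  have hp : ‖(p : Cn n)‖ = 1 := norm_eq_of_mem_sphere p
  have hq : ‖(q : Cn n)‖ = 1 := norm_eq_of_mem_sphere q
  let L : (ℂ ∙ (p : Cn n)) →ₗᵢ[ℂ] Cn n := (ℂ ∙ (q : Cn n)).subtypeₗᵢ.comp
    ((LinearIsometryEquiv.toSpanUnitSingleton (𝕜 := ℂ) (q : Cn n) hq).toLinearIsometry.comp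
      (LinearIsometryEquiv.toSpanUnitSingleton (𝕜 := ℂ) (p : Cn n) hp).symm.toLinearIsometry)
  obtain ⟨B, hB⟩ := exists_Un_toCLM_eq (L.extend.toLinearIsometryEquiv rfl)
  refine ⟨B, Subtype.ext ?_⟩
  have h1 : (LinearIsometryEquiv.toSpanUnitSingleton (𝕜 := ℂ) (p : Cn n) hp) 1 =
      ⟨p, Submodule.mem_span_singleton_self _⟩ := by ext1; simp
  have h2 := L.extend_apply ⟨p, Submodule.mem_span_singleton_self _⟩
  rw [Un.coe_smul, hB]
  refine h2.trans ?_
  rw [← h1]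
  change ((LinearIsometryEquiv.toSpanUnitSingleton (𝕜 := ℂ) (q : Cn n) hq
    ((LinearIsometryEquiv.toSpanUnitSingleton (𝕜 := ℂ) (p : Cn n) hp).symm
      (LinearIsometryEquiv.toSpanUnitSingleton (𝕜 := ℂ) (p : Cn n) hp 1)) :
      (ℂ ∙ (q : Cn n))) : Cn n) = q
  rw [LinearIsometryEquiv.symm_apply_apply]
  simp

/-- There is a unitary map that fixes `q` and is multiplication by `i` on its complement. -/
theorem exists_Un_rotation {n : ℕ} (q : UnitSphere n) :
    ∃ B : Un n, B.toCLM q = q ∧ ∀ u, inner ℂ (q : Cn n) u = 0 → B.toCLM u = Complex.I • u := by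
  have hq : inner ℂ (q : Cn n) (q : Cn n) = 1 := by
    rw [inner_self_eq_norm_sq_to_K, norm_eq_of_mem_sphere q]; simp
  let L : Cn n →ₗ[ℂ] Cn n := Complex.I • LinearMap.id +
    (1 - Complex.I) • ((innerSL ℂ (q : Cn n) : Cn n →ₗ[ℂ] ℂ).smulRight (q : Cn n))
  have hL : ∀ u, L u = Complex.I • u + ((1 - Complex.I) * inner ℂ (q : Cn n) u) • (q : Cn n) := by
    intro u; simp [L, smul_smul]
  let L' : Cn n →ₗᵢ[ℂ] Cn n := L.isometryOfInner fun u v => by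
    rw [hL, hL]
    simp only [inner_add_left, inner_add_right, inner_smul_left, inner_smul_right, hq, map_mul,
      map_sub, map_one, Complex.conj_I, inner_conj_symm]
    linear_combination ((- inner ℂ u v) + inner ℂ u (q : Cn n) * inner ℂ (q : Cn n) v) *
      Complex.I_sq
  obtain ⟨B, hB⟩ := exists_Un_toCLM_eq (L'.toLinearIsometryEquiv rfl)
  have hB' : ∀ u, B.toCLM u = L u := hB
  refine ⟨B, ?_, fun u hu => ?_⟩
  · rw [hB', hL, hq, ← add_smul]; simp
  · rw [hB', hL, hu]; simp

/-- The reflection in the complex span of `q` and `u`. -/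
theorem exists_Un_reflection {n : ℕ} (q u : Cn n) :
    ∃ B : Un n, B.toCLM q = q ∧ B.toCLM u = u ∧
      ∀ v, B.toCLM v = v → v ∈ Submodule.span ℂ {q, u} := by
  obtain ⟨B, hB⟩ := exists_Un_toCLM_eq (Submodule.span ℂ {q, u}).reflection
  refine ⟨B, ?_, ?_, fun v hv => ?_⟩
  · rw [hB]; exact Submodule.reflection_mem_subspace_eq_self (Submodule.subset_span (by simp))
  · rw [hB]; exact Submodule.reflection_mem_subspace_eq_self (Submodule.subset_span (by simp))
  · rw [hB] at hv; exact Submodule.reflection_eq_self_iff v |>.1 hv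

/-- The reflection in the complex line of `q`. -/
theorem exists_Un_reflection_line {n : ℕ} (q : Cn n) :
    ∃ B : Un n, B.toCLM q = q ∧ ∀ u, inner ℂ q u = 0 → B.toCLM u = -u := by
  obtain ⟨B, hB⟩ := exists_Un_toCLM_eq (Submodule.span ℂ {q}).reflection
  refine ⟨B, ?_, fun u hu => ?_⟩
  · rw [hB]; exact Submodule.reflection_mem_subspace_eq_self (Submodule.mem_span_singleton_self q)
  · rw [hB]
    exact Submodule.reflection_mem_subspace_orthogonalComplement_eq_neg
      (Submodule.mem_orthogonal_singleton_iff_inner_right.2 hu)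

section LinearAlgebra

variable {n : ℕ} {q : UnitSphere n} {D : Cn n →L[ℝ] Cn n}

theorem finrank_real_orthogonal [NeZero n] (q : UnitSphere n) :
    Module.finrank ℝ (ℝ ∙ (q : Cn n))ᗮ + 1 = Module.finrank ℝ (Cn n) := by
  have h := Submodule.finrank_add_finrank_orthogonal (ℝ ∙ (q : Cn n))
  rw [finrank_span_singleton (ne_zero_of_mem_unit_sphere q)] at h
  omega

/-- The image of the tangent space of the sphere under a map that is injective on it is a real
hyperplane of `ℂⁿ`. -/
theorem exists_dual_eq_zero_iff [NeZero n]
    (hinj : ∀ u, inner ℝ (q : Cn n) u = 0 → D u = 0 → u = 0) :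
    ∃ l : Cn n →ₗ[ℝ] ℝ, ∀ w, l w = 0 ↔ ∃ u, inner ℝ (q : Cn n) u = 0 ∧ D u = w := by
  let f := (D : Cn n →ₗ[ℝ] Cn n) ∘ₗ (ℝ ∙ (q : Cn n))ᗮ.subtype
  have hf : Function.Injective f := by
    rw [← LinearMap.ker_eq_bot, LinearMap.ker_eq_bot']
    exact fun u hu => Subtype.ext (hinj u (Submodule.mem_orthogonal_singleton_iff_inner_right.1 u.2) hu)
  have hV : Module.finrank ℝ (LinearMap.range f) + 1 = Module.finrank ℝ (Cn n) := by
    rw [LinearMap.finrank_range_of_inj hf, finrank_real_orthogonal]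
  have hlt : LinearMap.range f < ⊤ := by
    rw [lt_top_iff_ne_top]
    intro h
    rw [h, finrank_top] at hV
    omega
  obtain ⟨l, hl, hle⟩ := (LinearMap.range f).exists_le_ker_of_lt_top hlt
  have hk := Module.Dual.finrank_ker_add_one_of_ne_zero (f := l) hl
  have hker : LinearMap.range f = LinearMap.ker l := Submodule.eq_of_le_of_finrank_eq hle (by omega)
  refine ⟨l, fun w => ?_⟩
  rw [← LinearMap.mem_ker, ← hker, LinearMap.mem_range]
  constructor
  · rintro ⟨u, hu⟩
    exact ⟨u, Submodule.mem_orthogonal_singleton_iff_inner_right.1 u.2, hu⟩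
  · rintro ⟨u, hu, h⟩
    exact ⟨⟨u, Submodule.mem_orthogonal_singleton_iff_inner_right.2 hu⟩, h⟩

theorem inner_I_smul_self (q : UnitSphere n) : inner ℝ (q : Cn n) (Complex.I • (q : Cn n)) = 0 := by
  rw [inner_real_eq, inner_smul_right, inner_self_eq_norm_sq_to_K, norm_eq_of_mem_sphere]; simp

theorem UnitSphere.inner_self (q : UnitSphere n) : inner ℂ (q : Cn n) (q : Cn n) = 1 := by
  rw [inner_self_eq_norm_sq_to_K, norm_eq_of_mem_sphere q]; simp

theorem Un.inner_toCLM {n : ℕ} (A : Un n) (u v : Cn n) :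
    inner ℂ (A.toCLM u) (A.toCLM v) = inner ℂ u v :=
  LinearIsometry.inner_map_map ⟨(A.toCLM : Cn n →ₗ[ℂ] Cn n), Un.norm_toCLM A⟩ u v

theorem inner_toCLM_eq {A : Un n} {q : Cn n} (hA : A.toCLM q = q) (u : Cn n) :
    inner ℝ q (A.toCLM u) = inner ℝ q u := by
  rw [inner_real_eq, inner_real_eq]
  conv_lhs => rw [← hA]
  rw [Un.inner_toCLM]

theorem inner_eq_ofReal_mul_I {q u : Cn n} (hu : inner ℝ q u = 0) :
    inner ℂ q u = (inner ℂ q u).im * Complex.I := by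
  rw [inner_real_eq] at hu
  conv_lhs => rw [← Complex.re_add_im (inner ℂ q u), hu]
  simp

theorem inner_real_of_inner_complex {q u : Cn n} (hu : inner ℂ q u = 0) : inner ℝ q u = 0 := by
  rw [inner_real_eq, hu, Complex.zero_re]

theorem eq_zero_of_eq_neg {x : Cn n} (h : x = -x) : x = 0 := by
  have h2 : (2 : ℝ) • x = 0 := by
    rw [two_smul]
    nth_rw 2 [h]
    exact add_neg_cancel x
  exact (smul_eq_zero.1 h2).resolve_left two_ne_zero

variable (hinj : ∀ u, inner ℝ (q : Cn n) u = 0 → D u = 0 → u = 0)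
  (hT : ∀ A : Un n, A.toCLM q = q → ∃ T : Cn n →L[ℂ] Cn n, ∀ u, D (A.toCLM u) = T (D u))
include hinj

theorem eq_of_map_eq {u v : Cn n} (hu : inner ℝ (q : Cn n) u = 0) (hv : inner ℝ (q : Cn n) v = 0)
    (h : D u = D v) : u = v :=
  sub_eq_zero.1 (hinj _ (by rw [inner_sub_right, hu, hv, sub_self]) (by rw [map_sub, h, sub_self]))

include hT

/-- The solution of `D u' = i D u` is fixed by every unitary map that fixes `q` and `u`. -/
theorem toCLM_eq_self_of_map_eq {u u' : Cn n}
    (hu' : inner ℝ (q : Cn n) u' = 0) (h : D u' = Complex.I • D u) {A : Un n}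
    (hA : A.toCLM q = q) (hAu : A.toCLM u = u) : A.toCLM u' = u' := by
  obtain ⟨T, hT⟩ := hT A hA
  refine eq_of_map_eq hinj ((inner_toCLM_eq hA u').trans hu') hu' ?_
  rw [hT, h, map_smul, ← hT, hAu]

/-- The image of `i q` is not in the maximal complex subspace of the image of the tangent space: its
product with `i` would be the image of a real multiple of `i q`. -/
theorem not_exists_map_eq_I_smul_map_I_smul :
    ¬ ∃ u, inner ℝ (q : Cn n) u = 0 ∧ D u = Complex.I • D (Complex.I • (q : Cn n)) := by
  rintro ⟨u, hu, h⟩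
  obtain ⟨A, hAq, hA⟩ := exists_Un_reflection_line (q : Cn n)
  have h1 : A.toCLM u = u :=
    toCLM_eq_self_of_map_eq hinj hT hu h hAq (by rw [map_smul, hAq])
  have h2 := hA (u - inner ℂ (q : Cn n) u • (q : Cn n)) (by
    rw [inner_sub_right, inner_smul_right, UnitSphere.inner_self, mul_one, sub_self])
  rw [map_sub, map_smul, hAq, h1] at h2
  replace h2 := eq_zero_of_eq_neg h2
  rw [sub_eq_zero, inner_eq_ofReal_mul_I hu,
    mul_smul, Complex.coe_smul] at h2
  rw [h2, D.map_smul, ← Complex.coe_smul, ← sub_eq_zero, ← sub_smul, smul_eq_zero] at h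
  rcases h with h | h
  · have := congrArg Complex.im h
    simp at this
  · have := hinj _ (inner_I_smul_self q) h
    rw [smul_eq_zero] at this
    exact this.elim Complex.I_ne_zero (ne_zero_of_mem_unit_sphere q)

/-- If `i D u` is again the image of a tangent vector, then `u` is complex-orthogonal to `q`. -/
theorem inner_eq_zero_of_map_eq_I_smul {u u' : Cn n} (hu : inner ℝ (q : Cn n) u = 0)
    (hu' : inner ℝ (q : Cn n) u' = 0) (h : D u' = Complex.I • D u) : inner ℂ (q : Cn n) u = 0 := by
  obtain ⟨A, hAq, hA⟩ := exists_Un_reflection_line (q : Cn n)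
  obtain ⟨T, hTA⟩ := hT A hAq
  have h2 := hA (u - inner ℂ (q : Cn n) u • (q : Cn n)) (by
    rw [inner_sub_right, inner_smul_right, UnitSphere.inner_self, mul_one, sub_self])
  have hc := inner_eq_ofReal_mul_I hu
  set b := (inner ℂ (q : Cn n) u).im
  have h3 : u + A.toCLM u = (2 * b) • Complex.I • (q : Cn n) := by
    rw [map_sub, map_smul, hAq, hc] at h2
    rw [← Complex.coe_smul]
    push_cast
    linear_combination (norm := module) h2
  by_contra hne
  have hb : (2 * b) ≠ 0 := by
    intro hb
    have hb' : b = 0 := by linarith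
    exact hne (by rw [hc, hb']; simp)
  refine not_exists_map_eq_I_smul_map_I_smul hinj hT ⟨(2 * b)⁻¹ • (u' + A.toCLM u'), ?_, ?_⟩
  · rw [inner_smul_right, inner_add_right, inner_toCLM_eq hAq, hu']; simp
  · have h4 : D (u' + A.toCLM u') = (2 * b) • Complex.I • D (Complex.I • (q : Cn n)) := by
      rw [map_add, hTA, h, map_smul, ← hTA, ← smul_add, ← map_add, h3, D.map_smul, smul_comm]
    rw [map_smul, h4, inv_smul_smul₀ hb]

/-- The converse of `inner_eq_zero_of_map_eq_I_smul`: `i D u` is the image of a tangent vector if `u`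
is complex-orthogonal to `q`. -/
theorem exists_map_eq_I_smul [NeZero n] {u : Cn n} (hu : inner ℂ (q : Cn n) u = 0) :
    ∃ u', inner ℝ (q : Cn n) u' = 0 ∧ D u' = Complex.I • D u := by
  obtain ⟨l, hl⟩ := exists_dual_eq_zero_iff hinj
  have hu0 := inner_real_of_inner_complex hu
  have h0 : l (Complex.I • D (Complex.I • (q : Cn n))) ≠ 0 := fun h =>
    not_exists_map_eq_I_smul_map_I_smul hinj hT ((hl _).1 h)
  set r := l (Complex.I • D u) / l (Complex.I • D (Complex.I • (q : Cn n))) with hr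
  have h1 : l (Complex.I • D (u - r • Complex.I • (q : Cn n))) = 0 := by
    rw [map_sub, smul_sub, D.map_smul, smul_comm, map_sub, l.map_smul, smul_eq_mul, hr,
      div_mul_cancel₀ _ h0, sub_self]
  obtain ⟨u', hu', h⟩ := (hl _).1 h1
  have h2 := inner_eq_zero_of_map_eq_I_smul hinj hT (u := u - r • Complex.I • (q : Cn n)) (by
    rw [inner_sub_right, inner_smul_right, inner_I_smul_self, hu0]; simp) hu' h
  have hr0 : r = 0 := by
    rw [inner_sub_right, hu, ← Complex.coe_smul, inner_smul_right, inner_smul_right,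
      UnitSphere.inner_self] at h2
    simpa using h2
  rw [hr0, zero_smul, sub_zero] at h
  exact ⟨u', hu', h⟩

/-- On each vector complex-orthogonal to `q`, the differential is complex-linear or antilinear. -/
theorem map_I_smul_eq_or_eq_neg [NeZero n] {u : Cn n} (hu : inner ℂ (q : Cn n) u = 0) :
    D (Complex.I • u) = Complex.I • D u ∨ D (Complex.I • u) = - Complex.I • D u := by
  by_cases hx : D u = 0
  · have h0 := hinj u (inner_real_of_inner_complex hu) hx
    left; simp [h0]
  obtain ⟨u', hu', h⟩ := exists_map_eq_I_smul hinj hT hu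
  have hq' : inner ℂ (q : Cn n) u' = 0 :=
    inner_eq_zero_of_map_eq_I_smul hinj hT (u' := -u) hu' (by
      rw [inner_neg_right, inner_real_of_inner_complex hu, neg_zero]) (by
      rw [map_neg, h, smul_smul, Complex.I_mul_I, neg_one_smul])
  -- The reflection in the span of `q` and `u` shows that `u'` is a complex multiple `β u`.
  obtain ⟨A, hAq, hAu, hA⟩ := exists_Un_reflection (q : Cn n) u
  have h1 := hA u' (toCLM_eq_self_of_map_eq hinj hT hu' h hAq hAu)
  obtain ⟨α, β, rfl⟩ := Submodule.mem_span_pair.1 h1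
  have hα : α = 0 := by
    simpa [inner_add_right, inner_smul_right, hu, UnitSphere.inner_self] using hq'
  subst hα
  simp only [zero_smul, zero_add] at h hq'
  -- The rotation by `i` gives the same relation for `i u`, and the two relations determine `β = ±i`.
  obtain ⟨B, hBq, hB⟩ := exists_Un_rotation q
  obtain ⟨T, hTB⟩ := hT B hBq
  have h' : D (β • Complex.I • u) = Complex.I • D (Complex.I • u) := by
    rw [smul_comm, ← hB _ hq', hTB, h, map_smul, ← hTB, hB u hu]
  have e1 : β • u = β.re • u + β.im • Complex.I • u := by
    rw [← Complex.coe_smul, ← Complex.coe_smul, smul_smul, ← add_smul, Complex.re_add_im]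
  have e2 : β • Complex.I • u = β.re • Complex.I • u - β.im • u := by
    rw [smul_comm, e1, smul_add, smul_comm Complex.I β.re, smul_comm Complex.I β.im, smul_smul Complex.I,
      Complex.I_mul_I, neg_one_smul, smul_neg, sub_eq_add_neg]
  rw [e1, map_add, D.map_smul, D.map_smul, ← Complex.coe_smul, ← Complex.coe_smul] at h
  rw [e2, map_sub, D.map_smul, D.map_smul, ← Complex.coe_smul, ← Complex.coe_smul] at h'
  set x := D u
  set y := D (Complex.I • u)
  set a := β.re
  set b := β.im
  have h3 : ((Complex.I - a) ^ 2 + b ^ 2) • x = 0 := by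
    linear_combination (norm := module) (a - Complex.I) • h - (b : ℂ) • h'
  have h4 := (smul_eq_zero.1 h3).resolve_right hx
  have h5 : (Complex.I - a) ^ 2 + (b : ℂ) ^ 2 =
      ((a ^ 2 + b ^ 2 - 1 : ℝ) : ℂ) + ((-2 * a : ℝ) : ℂ) * Complex.I := by
    push_cast
    linear_combination Complex.I_sq
  rw [h5] at h4
  have h6 := congrArg Complex.im h4
  have h7 := congrArg Complex.re h4
  simp only [Complex.add_im, Complex.add_re, Complex.mul_re, Complex.mul_im, Complex.ofReal_im,
    Complex.ofReal_re, Complex.I_re, Complex.I_im, mul_one, mul_zero, zero_add, add_zero,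
    sub_zero, Complex.zero_im, Complex.zero_re] at h6 h7
  replace h6 : a = 0 := by linarith
  rw [h6] at h7 h
  have h8 : (b - 1) * (b + 1) = 0 := by linarith
  rcases mul_eq_zero.1 h8 with h9 | h9
  · left
    rw [show b = 1 by linarith] at h
    simpa using h
  · right
    rw [show b = -1 by linarith] at h
    simp at h
    rw [neg_smul, ← h, neg_neg]

/-- The sign in `map_I_smul_eq_or_eq_neg` does not depend on the vector. -/
theorem forall_map_I_smul_eq_or_forall_eq_neg [NeZero n] :
    (∀ u, inner ℂ (q : Cn n) u = 0 → D (Complex.I • u) = Complex.I • D u) ∨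
    (∀ u, inner ℂ (q : Cn n) u = 0 → D (Complex.I • u) = - Complex.I • D u) := by
  by_contra! hcon
  obtain ⟨⟨u, hu, hu1⟩, ⟨v, hv, hv1⟩⟩ := hcon
  have hu2 := (map_I_smul_eq_or_eq_neg hinj hT hu).resolve_left hu1
  have hv2 := (map_I_smul_eq_or_eq_neg hinj hT hv).resolve_right hv1
  have huv : inner ℂ (q : Cn n) (u + v) = 0 := by rw [inner_add_right, hu, hv, add_zero]
  have key : ∀ w : Cn n, inner ℂ (q : Cn n) w = 0 → Complex.I • D w = -Complex.I • D w → w = 0 := by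
    intro w hw h
    rw [neg_smul] at h
    replace h := smul_eq_zero.1 (eq_zero_of_eq_neg h)
    exact hinj w (inner_real_of_inner_complex hw) (h.resolve_left Complex.I_ne_zero)
  rcases map_I_smul_eq_or_eq_neg hinj hT huv with h | h
  · rw [smul_add, map_add, map_add, smul_add, hu2, hv2, add_left_inj] at h
    exact hu1 (by rw [key u hu h.symm]; simp)
  · rw [smul_add, map_add, map_add, smul_add, hu2, hv2, add_right_inj] at h
    exact hv1 (by rw [key v hv h]; simp)

end LinearAlgebra

/-! ### Complex conjugation and the CR-dichotomy -/

/-- Coordinatewise complex conjugation on `ℂⁿ`. -/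
def conjCn (n : ℕ) : Cn n ≃ₗᵢ[ℝ] Cn n :=
  LinearIsometryEquiv.piLpCongrRight 2 (fun _ => Complex.conjLIE)

theorem conjCn_apply {n : ℕ} (z : Cn n) (i : Fin n) : conjCn n z i = star (z i) := rfl

theorem conjCn_conjCn {n : ℕ} (z : Cn n) : conjCn n (conjCn n z) = z := by
  ext i; simp [conjCn_apply]

theorem conjCn_smul {n : ℕ} (c : ℂ) (z : Cn n) : conjCn n (c • z) = star c • conjCn n z := by
  ext i; simp [conjCn_apply]

theorem inner_conjCn {n : ℕ} (u v : Cn n) :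
    inner ℂ (conjCn n u) (conjCn n v) = star (inner ℂ u v) := by
  simp [PiLp.inner_apply, conjCn_apply]

theorem conjCn_toCLM {n : ℕ} (A : Un n) (z : Cn n) :
    conjCn n (A.toCLM z) = (conjUn n A).toCLM (conjCn n z) := by
  ext i
  change star (((A : Matrix (Fin n) (Fin n) ℂ) *ᵥ z.ofLp) i) =
    (((A : Matrix (Fin n) (Fin n) ℂ).map star) *ᵥ (conjCn n z).ofLp) i
  simp [Matrix.mulVec, dotProduct, conjCn_apply]

/-- Complex conjugation on the sphere. -/
def UnitSphere.conj {n : ℕ} (q : UnitSphere n) : UnitSphere n :=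
  ⟨conjCn n q, by rw [mem_sphere_zero_iff_norm, LinearIsometryEquiv.norm_map]; exact norm_eq_of_mem_sphere q⟩

theorem UnitSphere.conj_smul {n : ℕ} (A : Un n) (q : UnitSphere n) :
    (A • q).conj = conjUn n A • q.conj :=
  Subtype.ext (conjCn_toCLM A q)

theorem UnitSphere.conj_conj {n : ℕ} (q : UnitSphere n) : q.conj.conj = q :=
  Subtype.ext (conjCn_conjCn _)

theorem conjUn_mem_Zm {n m : ℕ} {A : Un n} (hA : A ∈ Zm n m) : conjUn n A ∈ Zm n m := by
  have h : ((conjQuot n m) (A : Un n ⧸ Zm n m)) = 1 := by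
    rw [(QuotientGroup.eq_one_iff A).2 hA, map_one]
  exact (QuotientGroup.eq_one_iff _).1 h

theorem conjUn_conjUn {n : ℕ} (A : Un n) : conjUn n (conjUn n A) = A := by
  apply Subtype.ext
  change ((A : Matrix (Fin n) (Fin n) ℂ).map star).map star = A
  ext i j; simp

/-- Complex conjugation on the lens manifold. -/
def Lens.conj {n m : ℕ} : Lens n m → Lens n m :=
  Quotient.map UnitSphere.conj (by
    intro p q h
    obtain ⟨A, rfl⟩ := MulAction.orbitRel_apply.1 h
    refine MulAction.orbitRel_apply.2 ⟨⟨conjUn n A, conjUn_mem_Zm A.2⟩, ?_⟩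
    exact (UnitSphere.conj_smul (A : Un n) q).symm)

theorem Lens.conj_mk {n m : ℕ} (q : UnitSphere n) :
    Lens.conj (Lens.mk n m q) = Lens.mk n m q.conj := rfl

theorem Lens.conj_conj {n m : ℕ} (x : Lens n m) : x.conj.conj = x := by
  induction x using Quotient.inductionOn with
  | h q => exact congrArg (Lens.mk n m) q.conj_conj

theorem Lens.conj_smul {n m : ℕ} (g : Un n ⧸ Zm n m) (x : Lens n m) :
    (g • x).conj = conjQuot n m g • x.conj := by
  induction g using QuotientGroup.induction_on with
  | H A =>
    induction x using Quotient.inductionOn with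
    | h q => exact congrArg (Lens.mk n m) (UnitSphere.conj_smul A q)

theorem Lens.contMDiff_conj {n m : ℕ} [NeZero n] [NeZero m] :
    ContMDiff (𝓡 (2 * n - 1)) (𝓡 (2 * n - 1)) ∞ (Lens.conj : Lens n m → Lens n m) := by
  apply Lens.contMDiff_of_comp_mk
  have h : ContMDiff (𝓡 (2 * n - 1)) (𝓡 (2 * n - 1)) ∞ (UnitSphere.conj : UnitSphere n → _) := by
    apply UnitSphere.contMDiff_of_coe
    have h1 : ContMDiff 𝓘(ℝ, Cn n) 𝓘(ℝ, Cn n) ∞ (conjCn n) :=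
      (conjCn n).contDiff.contMDiff
    exact h1.comp contMDiff_coe_sphere
  exact (Lens.contMDiff_mk n m).comp h

section CR

variable {n m : ℕ} [NeZero n] [NeZero m] {M : Type*} [TopologicalSpace M] [ChartedSpace (Cn n) M]

theorem IsDiffeoOnto.comp_conj {F : Lens n m → M} {S : Set M} (hF : IsDiffeoOnto F S) :
    IsDiffeoOnto (F ∘ Lens.conj) S := by
  obtain ⟨h1, h2, G, hG, hGF⟩ := hF
  refine ⟨h1.comp Lens.contMDiff_conj, ?_, Lens.conj ∘ G, Lens.contMDiff_conj.comp_contMDiffOn hG,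
    fun x => ?_⟩
  · rw [Set.range_comp, Function.Surjective.range_eq (fun x => ⟨x.conj, x.conj_conj⟩),
      Set.image_univ, h2]
  · simp only [Function.comp_apply, hGF, Lens.conj_conj]

theorem coneDeriv_comp_conj {F : Lens n m → M}
    (hF : ContMDiff (𝓡 (2 * n - 1)) 𝓘(ℝ, Cn n) ∞ F) (q : UnitSphere n) (u : Cn n) :
    coneDeriv (F ∘ Lens.conj) q u = coneDeriv F q.conj (conjCn n u) := by
  have hq := ne_zero_of_mem_unit_sphere q
  have hq' : conjCn n (q : Cn n) ≠ 0 := ne_zero_of_mem_unit_sphere q.conj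
  have h1 : HasMFDerivAt 𝓘(ℝ, Cn n) 𝓘(ℝ, Cn n) (conjCn n) (q : Cn n)
      (conjCn n : Cn n →L[ℝ] Cn n) :=
    (conjCn n : Cn n →L[ℝ] Cn n).hasFDerivAt.hasMFDerivAt
  have h2 := (((contMDiffAt_coneLift hF hq').mdifferentiableAt (by simp)).hasMFDerivAt).comp (q : Cn n) h1
  have he : coneLift (F ∘ Lens.conj) =ᶠ[nhds (q : Cn n)] coneLift F ∘ conjCn n := by
    filter_upwards [isOpen_ne.mem_nhds hq] with z hz
    have hz' : conjCn n z ≠ 0 := by simpa using hz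
    have : unitVec (conjCn n z) = (unitVec z).conj := by
      apply Subtype.ext
      rw [unitVec_coe hz']
      change _ = conjCn n (unitVec z)
      rw [unitVec_coe hz, LinearIsometryEquiv.norm_map, map_smul]
    simp only [Function.comp_apply, coneLift, this, Lens.conj_mk]
  exact DFunLike.congr_fun (h2.congr_of_eventuallyEq he).mfderiv u

/-- Each unitary transformation of the lens manifold corresponds under `F` to a holomorphic map of
`M`. -/
def HolomorphicallyEquivariant (F : Lens n m → M) : Prop :=
  ∀ A : Un n, ∃ g : M → M, ContMDiff 𝓘(ℂ, Cn n) 𝓘(ℂ, Cn n) ω g ∧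
    ∀ q : UnitSphere n, F (Lens.mk n m (A • q)) = g (F (Lens.mk n m q))

theorem HolomorphicallyEquivariant.comp_conj {F : Lens n m → M}
    (hF : HolomorphicallyEquivariant F) : HolomorphicallyEquivariant (F ∘ Lens.conj) := by
  intro A
  obtain ⟨g, hg, h⟩ := hF (conjUn n A)
  refine ⟨g, hg, fun q => ?_⟩
  simp only [Function.comp_apply, Lens.conj_mk, UnitSphere.conj_smul, h]

theorem HolomorphicallyEquivariant.exists_stabilizer {F : Lens n m → M}
    (hF : ContMDiff (𝓡 (2 * n - 1)) 𝓘(ℝ, Cn n) ∞ F) (he : HolomorphicallyEquivariant F)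
    (q : UnitSphere n) (A : Un n) (hA : A.toCLM q = q) :
    ∃ T : Cn n →L[ℂ] Cn n, ∀ u, coneDeriv F q (A.toCLM u) = T (coneDeriv F q u) := by
  obtain ⟨g, hg, h⟩ := he A
  obtain ⟨T, hT⟩ := coneDeriv_equivariant hF hg A h q
  rw [hA] at hT
  exact ⟨T, hT⟩

theorem coneDeriv_injOn {F : Lens n m → M} {S : Set M} (hF : IsDiffeoOnto F S) (q : UnitSphere n)
    (hq : Function.Surjective
      (mfderiv (𝓡 (2 * n - 1)) (𝓡 (2 * n - 1)) (Lens.mk n m) q))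
    (u : Cn n) (hu : inner ℝ (q : Cn n) u = 0) (h : coneDeriv F q u = 0) : u = 0 := by
  obtain ⟨v, rfl⟩ := exists_mvfderiv_val_eq hu
  rw [coneDeriv_mvfderiv_val hF.1] at h
  let T : EuclideanSpace ℝ (Fin (2 * n - 1)) →L[ℝ] EuclideanSpace ℝ (Fin (2 * n - 1)) :=
    mfderiv (𝓡 (2 * n - 1)) (𝓡 (2 * n - 1)) (Lens.mk n m) q
  have hinj : Function.Injective T :=
    (LinearMap.injective_iff_surjective (f := T.toLinearMap)).2 hq
  have h1 := mfderiv_injective_of_isDiffeoOnto hF _ (h.trans (map_zero _).symm)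
  have h2 : v = (0 : TangentSpace (𝓡 (2 * n - 1)) q) := hinj (h1.trans (map_zero _).symm)
  rw [h2, map_zero]

/-- An equivariant diffeomorphism whose differential is complex-linear on the complex tangent spaces
of the sphere is CR. -/
theorem isCRDiffeoOnto_of_coneDeriv {F : Lens n m → M} {S : Set M} (hF : IsDiffeoOnto F S)
    (he : HolomorphicallyEquivariant F)
    (hI : ∀ (q : UnitSphere n) (u : Cn n), inner ℂ (q : Cn n) u = 0 →
      coneDeriv F q (Complex.I • u) = Complex.I • coneDeriv F q u) :
    IsCRDiffeoOnto F S := by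
  refine ⟨hF, fun x v w => ⟨?_, ?_⟩⟩
  · rintro ⟨q, v', w', rfl, hvw, rfl, rfl⟩
    have hv0 := inner_mvfderiv_val q v'
    have hw0 := inner_mvfderiv_val q w'
    have e1 := coneDeriv_mvfderiv_val hF.1 q v'
    have e2 := coneDeriv_mvfderiv_val hF.1 q w'
    rw [hvw] at e2 hw0
    have hc : inner ℂ (q : Cn n)
        (mvfderiv (𝓡 (2 * n - 1)) (Subtype.val : UnitSphere n → Cn n) q v') = 0 := by
      rw [inner_real_eq] at hv0 hw0
      rw [inner_smul_right] at hw0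
      apply Complex.ext
      · exact hv0
      · simpa using hw0
    have t1 := mem_tangentTo_of_inner_eq_zero hF q hv0
    have t2 := mem_tangentTo_of_inner_eq_zero hF q hw0
    have hI' := hI q _ hc
    rw [e1] at t1
    rw [e2] at t2
    rw [e1, e2] at hI'
    rw [coneLift_coe] at t1 t2
    exact ⟨t1, t2, hI'⟩
  · rintro ⟨-, -, hvw⟩
    obtain ⟨q, rfl, hq⟩ := Lens.exists_surjective_mfderiv_mk x
    obtain ⟨v', rfl⟩ := hq v
    obtain ⟨w', rfl⟩ := hq w
    refine ⟨q, v', w', rfl, ?_, rfl, rfl⟩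
    have hv0 := inner_mvfderiv_val q v'
    have hw0 := inner_mvfderiv_val q w'
    have e1 := coneDeriv_mvfderiv_val hF.1 q v'
    have e2 := coneDeriv_mvfderiv_val hF.1 q w'
    have hvw' : coneDeriv F q
        (mvfderiv (𝓡 (2 * n - 1)) (Subtype.val : UnitSphere n → Cn n) q w') = Complex.I •
        coneDeriv F q (mvfderiv (𝓡 (2 * n - 1)) (Subtype.val : UnitSphere n → Cn n) q v') := by
      rw [e1, e2]; exact hvw
    have hinj := coneDeriv_injOn hF q hq
    have hc := inner_eq_zero_of_map_eq_I_smul hinj (he.exists_stabilizer hF.1 q) hv0 hw0 hvw'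
    refine eq_of_map_eq hinj hw0 ?_ (hvw'.trans (hI q _ hc).symm)
    exact inner_real_of_inner_complex (by rw [inner_smul_right, hc, mul_zero])

theorem Un.toCLM_inv_apply {n : ℕ} (A : Un n) (u : Cn n) : A.toCLM (A⁻¹.toCLM u) = u := by
  change (WithLp.toLp 2 ((A : Matrix (Fin n) (Fin n) ℂ) *ᵥ
    ((A⁻¹ : Un n) : Matrix (Fin n) (Fin n) ℂ) *ᵥ u.ofLp)) = u
  rw [Matrix.mulVec_mulVec, ← Submonoid.coe_mul, mul_inv_cancel]
  simp

/-- By transitivity, homogeneity of the differential at one point of the sphere propagates to all. -/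
theorem coneDeriv_smul_of_exists {F : Lens n m → M}
    (hF : ContMDiff (𝓡 (2 * n - 1)) 𝓘(ℝ, Cn n) ∞ F) (he : HolomorphicallyEquivariant F) {c d : ℂ}
    {q : UnitSphere n}
    (h : ∀ u : Cn n, inner ℂ (q : Cn n) u = 0 → coneDeriv F q (c • u) = d • coneDeriv F q u)
    (p : UnitSphere n) (u : Cn n) (hu : inner ℂ (p : Cn n) u = 0) :
    coneDeriv F p (c • u) = d • coneDeriv F p u := by
  obtain ⟨A, rfl⟩ := UnitSphere.exists_smul_eq q p
  obtain ⟨g, hg, hA⟩ := he A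
  obtain ⟨T, hT⟩ := coneDeriv_equivariant hF hg A hA q
  rw [← A.toCLM_inv_apply u, Un.coe_smul] at hu ⊢
  rw [Un.inner_toCLM] at hu
  rw [← map_smul, hT, hT, h _ hu, map_smul]

/-- An equivariant diffeomorphism is CR, possibly after composition with complex conjugation. -/
theorem isCRDiffeoOnto_or_comp_conj {F : Lens n m → M} {S : Set M} (hF : IsDiffeoOnto F S)
    (he : HolomorphicallyEquivariant F) :
    IsCRDiffeoOnto F S ∨ IsCRDiffeoOnto (F ∘ Lens.conj) S := by
  obtain ⟨q, -, hq⟩ := Lens.exists_surjective_mfderiv_mk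
    (Lens.mk n m ⟨EuclideanSpace.single 0 1, by simp⟩)
  rcases forall_map_I_smul_eq_or_forall_eq_neg (coneDeriv_injOn hF q hq)
    (he.exists_stabilizer hF.1 q) with h | h
  · exact .inl (isCRDiffeoOnto_of_coneDeriv hF he (coneDeriv_smul_of_exists hF.1 he h))
  · refine .inr (isCRDiffeoOnto_of_coneDeriv hF.comp_conj he.comp_conj fun p u hu => ?_)
    rw [coneDeriv_comp_conj hF.1, coneDeriv_comp_conj hF.1, conjCn_smul]
    have h1 : inner ℂ (p.conj : Cn n) (conjCn n u) = 0 := by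
      change inner ℂ (conjCn n p) (conjCn n u) = 0
      rw [inner_conjCn, hu, star_zero]
    have h2 := coneDeriv_smul_of_exists hF.1 he h p.conj _ h1
    rw [show star Complex.I = -Complex.I from Complex.conj_I, neg_smul, map_neg, h2, neg_smul,
      neg_neg]

end CR

/-! ### Unitary representations: diagonalization and characters -/

/-- A continuous character of the circle is a power: otherwise all its Fourier coefficients vanish by
invariance of the integral. -/
theorem Circle.exists_zpow_of_continuous (f : Circle →* Circle) (hf : Continuous f) :
    ∃ k : ℤ, ∀ z, f z = z ^ k := by
  have : Fact ((0 : ℝ) < 1) := ⟨one_pos⟩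
  let F : C(AddCircle (1 : ℝ), ℂ) :=
    ⟨fun t => f (AddCircle.toCircle t), by
      have := AddCircle.continuous_toCircle (T := (1:ℝ)); fun_prop⟩
  have hFadd : ∀ s t, F (s + t) = F s * F t := fun s t => by
    simp only [F, ContinuousMap.coe_mk, AddCircle.toCircle_add, map_mul, Circle.coe_mul]
  by_contra! hcon
  have hcoef : ∀ k : ℤ, fourierCoeff F k = 0 := by
    intro k
    obtain ⟨z, hz⟩ := hcon k
    obtain ⟨s, rfl⟩ := (AddCircle.homeomorphCircle (T := (1 : ℝ)) one_ne_zero).surjective z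
    rw [AddCircle.homeomorphCircle_apply] at hz
    let G : AddCircle (1 : ℝ) → ℂ := fun t => fourier (-k) t • F t
    have hG : ∀ t, G (s + t) = G s * G t := fun t => by
      have h1 : (fourier (-k) (s + t) : ℂ) = fourier (-k) s * fourier (-k) t := by
        simp only [fourier_apply, smul_add, AddCircle.toCircle_add, Circle.coe_mul]
      simp only [G, hFadd, h1, smul_eq_mul]
      ring
    have h1 : fourierCoeff F k = G s * fourierCoeff F k := by
      calc fourierCoeff F k = ∫ t, G t ∂AddCircle.haarAddCircle := rfl
        _ = ∫ t, G (s + t) ∂AddCircle.haarAddCircle :=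
          (MeasureTheory.integral_add_left_eq_self G s).symm
        _ = G s * ∫ t, G t ∂AddCircle.haarAddCircle := by
          simp_rw [hG]; exact MeasureTheory.integral_const_mul _ _
        _ = _ := rfl
    have h2 : G s ≠ 1 := by
      intro h
      apply hz
      simp only [G, fourier_apply, neg_smul, AddCircle.toCircle_neg, AddCircle.toCircle_zsmul, F,
        ContinuousMap.coe_mk, smul_eq_mul] at h
      rw [← Circle.coe_mul, Circle.coe_eq_one, inv_mul_eq_one] at h
      exact h.symm
    have h3 : (G s - 1) * fourierCoeff F k = 0 := by rw [sub_mul, one_mul, ← h1, sub_self]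
    exact (mul_eq_zero.1 h3).resolve_left (sub_ne_zero.2 h2)
  have hs := has_pointwise_sum_fourier_series_of_summable (f := F)
    (by simp only [funext hcoef]; exact summable_zero) 0
  simp only [hcoef, zero_smul] at hs
  have h0 := hs.unique hasSum_zero
  simp [F] at h0

/-- Commuting unitary matrices are simultaneously diagonalizable by a unitary matrix; a joint
eigenbasis of their Hermitian and anti-Hermitian parts provides it. -/
theorem exists_unitary_forall_eq_diagonal {n : ℕ} {ι : Type*} (U : ι → Un n)
    (hU : ∀ i j, Commute (U i) (U j)) :
    ∃ h : Un n, ∀ i, ∃ d : Fin n → ℂ,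
      ((h⁻¹ * U i * h : Un n) : Matrix (Fin n) (Fin n) ℂ) = Matrix.diagonal d := by
  classical
  let H : ι × Bool → Matrix (Fin n) (Fin n) ℂ := fun p =>
    if p.2 then (U p.1 : Matrix (Fin n) (Fin n) ℂ) + star (U p.1 : Matrix (Fin n) (Fin n) ℂ)
    else Complex.I • ((U p.1 : Matrix (Fin n) (Fin n) ℂ) - star (U p.1 : Matrix (Fin n) (Fin n) ℂ))
  have hH : ∀ p, (H p).IsHermitian := by
    rintro ⟨i, b⟩
    cases b
    · simp only [H, Matrix.IsHermitian, ← Matrix.star_eq_conjTranspose, star_smul, star_sub,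
        star_star, Bool.false_eq_true, if_false, Complex.star_def, Complex.conj_I]
      module
    · simp only [H, Matrix.IsHermitian, ← Matrix.star_eq_conjTranspose, star_add, star_star, if_true]
      rw [add_comm]
  have hcomm : ∀ p p', Commute (H p) (H p') := by
    have c1 : ∀ i j, Commute (U i : Matrix (Fin n) (Fin n) ℂ) (U j : Matrix (Fin n) (Fin n) ℂ) :=
      fun i j => congrArg Subtype.val (hU i j)
    have c2 : ∀ i j, Commute (U i : Matrix (Fin n) (Fin n) ℂ) (star (U j : Matrix (Fin n) (Fin n) ℂ)) :=
      fun i j => congrArg Subtype.val (hU i j).inv_right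
    have c3 : ∀ i j, Commute (star (U i : Matrix (Fin n) (Fin n) ℂ)) (star (U j : Matrix (Fin n) (Fin n) ℂ)) :=
      fun i j => congrArg Subtype.val (hU i j).inv_inv
    rintro ⟨i, b⟩ ⟨j, b'⟩
    have k1 := c1 i j
    have k2 := c2 i j
    have k3 := (c2 j i).symm
    have k4 := c3 i j
    cases b <;> cases b' <;> simp only [H, Bool.false_eq_true, if_false, if_true]
    · exact (((k1.sub_right k2).sub_left (k3.sub_right k4)).smul_left _).smul_right _
    · exact (((k1.add_right k2).sub_left (k3.add_right k4)).smul_left _)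
    · exact (((k1.sub_right k2).add_left (k3.sub_right k4)).smul_right _)
    · exact (((k1.add_right k2).add_left (k3.add_right k4)))
  let T : ι × Bool → (Cn n →ₗ[ℂ] Cn n) := fun p => Matrix.toEuclideanLin (H p)
  have hT : ∀ p, (T p).IsSymmetric := fun p => Matrix.isSymmetric_toEuclideanLin_iff.2 (hH p)
  have hTc : Pairwise (Function.onFun Commute T) := by
    intro p p' _
    have hmul : ∀ p p' v, (T p * T p') v = WithLp.toLp 2 ((H p * H p') *ᵥ v.ofLp) := fun p p' v => by
      rw [← Matrix.mulVec_mulVec]; rfl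
    exact LinearMap.ext fun v => by rw [hmul, hmul, (hcomm p p').eq]
  let E : (ι × Bool → ℂ) → Submodule ℂ (Cn n) := fun χ => ⨅ p, Module.End.eigenspace (T p) (χ p)
  have hO := LinearMap.IsSymmetric.orthogonalFamily_iInf_eigenspaces hT
  have htop := LinearMap.IsSymmetric.iSup_iInf_eq_top_of_commute hT hTc
  let J := {χ // E χ ≠ ⊥}
  have : Fintype J := hO.independent.fintypeNeBotOfFiniteDimensional
  have hO' : OrthogonalFamily ℂ (fun χ : J => E χ) fun χ => (E χ).subtypeₗᵢ :=
    hO.comp Subtype.val_injective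
  have hint : DirectSum.IsInternal (fun χ : J => E χ) := by
    rw [OrthogonalFamily.isInternal_iff hO', Submodule.orthogonal_eq_bot_iff, ← htop]
    exact iSup_ne_bot_subtype E
  let b := hint.subordinateOrthonormalBasis (finrank_euclideanSpace_fin (𝕜 := ℂ) (n := n)) hO'
  have hb : ∀ k, ∃ χ : ι × Bool → ℂ, ∀ p, T p (b k) = χ p • b k := fun k => by
    have := hint.subordinateOrthonormalBasis_subordinate
      (finrank_euclideanSpace_fin (𝕜 := ℂ) (n := n)) k hO'
    exact ⟨_, fun p => Module.End.mem_eigenspace_iff.1 ((Submodule.mem_iInf _).1 this p)⟩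
  choose χ hχ using hb
  let h : Un n := ⟨_, (EuclideanSpace.basisFun (Fin n) ℂ).toMatrix_orthonormalBasis_mem_unitary b⟩
  refine ⟨h, fun i => ⟨fun k => (χ k (i, true) - Complex.I * χ k (i, false)) / 2, ?_⟩⟩
  have hh : ∀ j k, (h : Matrix (Fin n) (Fin n) ℂ) j k = b k j := fun j k => by
    simp [h, Module.Basis.toMatrix_apply]
  have key : (U i : Matrix (Fin n) (Fin n) ℂ) * h =
      h * Matrix.diagonal fun k => (χ k (i, true) - Complex.I * χ k (i, false)) / 2 := by
    have e : (U i : Matrix (Fin n) (Fin n) ℂ) = (1 / 2 : ℂ) • (H (i, true) - Complex.I • H (i, false)) := by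
      simp only [H, Bool.false_eq_true, if_false, if_true, smul_smul, Complex.I_mul_I]
      module
    have f : ∀ p, H p * h = h * Matrix.diagonal fun k => χ k p := by
      intro p
      ext j k
      rw [Matrix.mul_diagonal, hh, Matrix.mul_apply]
      have := congrArg (fun v : Cn n => v j) (hχ k p)
      simp only [T, PiLp.smul_apply, smul_eq_mul] at this
      rw [mul_comm, ← this]
      simp only [hh]
      rfl
    rw [e, smul_mul_assoc, sub_mul, smul_mul_assoc, f, f, ← mul_smul_comm, ← mul_sub,
      ← mul_smul_comm, ← Matrix.diagonal_smul, Matrix.diagonal_sub, ← Matrix.diagonal_smul]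
    congr 2
    funext k
    simp
    ring
  rw [mul_assoc, Submonoid.coe_mul, Submonoid.coe_mul, key, ← mul_assoc, ← Submonoid.coe_mul, inv_mul_cancel]
  simp
instance Un.compactSpace (n : ℕ) : CompactSpace (Un n) := by
  refine isCompact_iff_compactSpace.1
    (?_ : IsCompact (Matrix.unitaryGroup (Fin n) ℂ : Set (Matrix (Fin n) (Fin n) ℂ)))
  have hK : IsCompact (Set.univ.pi fun _ => Set.univ.pi fun _ => Metric.closedBall 0 1 :
      Set (Fin n → Fin n → ℂ)) :=
    isCompact_univ_pi fun _ => isCompact_univ_pi fun _ => isCompact_closedBall _ _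
  refine IsCompact.of_isClosed_subset (X := Matrix (Fin n) (Fin n) ℂ) hK ?_ ?_
  · have : (Matrix.unitaryGroup (Fin n) ℂ : Set (Matrix (Fin n) (Fin n) ℂ)) =
        {A | A * star A = 1} := by
      ext A; exact Matrix.mem_unitaryGroup_iff
    rw [this]
    exact isClosed_eq (by fun_prop) continuous_const
  · intro A hA i _ j _
    rw [mem_closedBall_zero_iff]
    exact entry_norm_bound_of_unitary hA i j

theorem Un.continuous_entry {n : ℕ} (i j : Fin n) :
    Continuous fun A : Un n => (A : Matrix (Fin n) (Fin n) ℂ) i j :=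
  (continuous_apply_apply i j).comp continuous_subtype_val

/-- The diagonal torus of `U_n`. -/
def Un.diag (n : ℕ) : (Fin n → Circle) →* Un n where
  toFun t := ⟨Matrix.diagonal fun i => (t i : ℂ), by
    rw [Matrix.mem_unitaryGroup_iff, Matrix.star_eq_conjTranspose, Matrix.diagonal_conjTranspose,
      Matrix.diagonal_mul_diagonal, ← Matrix.diagonal_one]
    congr 1
    funext i
    simp [Complex.mul_conj]⟩
  map_one' := Subtype.ext (by simp)
  map_mul' s t := Subtype.ext (by simp [Matrix.diagonal_mul_diagonal])

theorem Un.diag_coe {n : ℕ} (t : Fin n → Circle) :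
    (Un.diag n t : Matrix (Fin n) (Fin n) ℂ) = Matrix.diagonal fun i => (t i : ℂ) := rfl

theorem Un.continuous_diag (n : ℕ) : Continuous (Un.diag n) := by
  refine Continuous.subtype_mk (Continuous.matrix_diagonal ?_) _
  fun_prop

/-- Permutation matrices as elements of `U_n`. -/
def Un.perm {n : ℕ} (σ : Equiv.Perm (Fin n)) : Un n :=
  ⟨σ.permMatrix ℂ, by
    rw [Matrix.mem_unitaryGroup_iff, Matrix.star_eq_conjTranspose, Matrix.conjTranspose_permMatrix,
      ← Matrix.permMatrix_mul, inv_mul_cancel, Matrix.permMatrix_one]⟩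

theorem Un.perm_apply {n : ℕ} (σ : Equiv.Perm (Fin n)) (i j : Fin n) :
    (Un.perm σ : Matrix (Fin n) (Fin n) ℂ) i j = if σ i = j then 1 else 0 := by
  simp [Un.perm, PEquiv.toMatrix_apply, eq_comm]

theorem Un.perm_mul_diag {n : ℕ} (σ : Equiv.Perm (Fin n)) (t : Fin n → Circle) :
    Un.perm σ * Un.diag n t = Un.diag n (t ∘ σ) * Un.perm σ := by
  apply Subtype.ext
  ext i j
  rw [Submonoid.coe_mul, Submonoid.coe_mul, Un.diag_coe, Un.diag_coe, Matrix.mul_diagonal,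
    Matrix.diagonal_mul, Un.perm_apply]
  split_ifs with h
  · simp [← h]
  · simp

/-- A matrix that commutes with all unitary matrices is scalar. -/
theorem exists_eq_smul_one_of_commute {n : ℕ} (X : Matrix (Fin n) (Fin n) ℂ)
    (hX : ∀ A : Un n, (A : Matrix (Fin n) (Fin n) ℂ) * X = X * A) : ∃ c : ℂ, X = c • 1 := by
  rcases isEmpty_or_nonempty (Fin n) with hn | ⟨⟨i0⟩⟩
  · exact ⟨0, Subsingleton.elim _ _⟩
  refine ⟨X i0 i0, ?_⟩
  ext i j
  rw [Matrix.smul_apply, smul_eq_mul]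
  by_cases hij : i = j
  · subst hij
    have h := congrFun (congrFun (hX (Un.perm (Equiv.swap i i0))) i) i0
    simp only [Matrix.mul_apply, Un.perm_apply, ite_mul, one_mul, zero_mul, mul_ite, mul_one,
      mul_zero, Finset.sum_ite_eq, Finset.mem_univ, if_true, Equiv.swap_apply_left] at h
    rw [Matrix.one_apply_eq, mul_one, h, Finset.sum_eq_single i]
    · simp
    · intro k _ hk
      exact if_neg fun h => hk ((Equiv.swap i i0).injective
        (h.trans (Equiv.swap_apply_left i i0).symm))
    · simp
  · have h := congrFun (congrFun (hX (Un.diag n (Function.update 1 i (-1)))) i) j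
    rw [Un.diag_coe, Matrix.mul_diagonal, Matrix.diagonal_mul, Function.update_self,
      Function.update_of_ne (Ne.symm hij)] at h
    rw [Matrix.one_apply_ne hij, mul_zero]
    simp at h
    linear_combination (-1 / 2 : ℂ) * h

/-- Two continuous unitary representations of dimension `n` with the same character have a nonzero
intertwiner. The averages `∫ r(A)_{ij} conj (s(A)_{kl})` are intertwiners, and if all of them vanished
then so would `∫ |tr r|²`. -/
theorem exists_intertwiner {n : ℕ} [NeZero n] {r s : Un n →* Un n} (hr : Continuous r) (hs : Continuous s)
    (htr : ∀ A, (r A : Matrix (Fin n) (Fin n) ℂ).trace = (s A : Matrix (Fin n) (Fin n) ℂ).trace) :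
    ∃ P : Matrix (Fin n) (Fin n) ℂ, P ≠ 0 ∧ ∀ A, (r A : Matrix (Fin n) (Fin n) ℂ) * P = P * s A := by
  let : MeasurableSpace (Un n) := borel _
  have : BorelSpace (Un n) := ⟨rfl⟩
  let μ : MeasureTheory.Measure (Un n) := MeasureTheory.Measure.haar
  have hint : ∀ f : Un n → ℂ, Continuous f → MeasureTheory.Integrable f μ := fun f hf =>
    hf.integrable_of_hasCompactSupport (HasCompactSupport.of_compactSpace f)
  have hrc : ∀ i j, Continuous fun A => (r A : Matrix (Fin n) (Fin n) ℂ) i j := fun i j =>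
    (Un.continuous_entry i j).comp hr
  have hsc : ∀ i j, Continuous fun A => star ((s A : Matrix (Fin n) (Fin n) ℂ) i j) := fun i j =>
    ((Un.continuous_entry i j).comp hs).star
  let P : Fin n → Fin n → Matrix (Fin n) (Fin n) ℂ := fun j l => Matrix.of fun i k =>
    ∫ A, (r A : Matrix (Fin n) (Fin n) ℂ) i j * star ((s A : Matrix (Fin n) (Fin n) ℂ) k l) ∂μ
  have hP : ∀ j l B, (r B : Matrix (Fin n) (Fin n) ℂ) * P j l = P j l * s B := by
    intro j l B
    ext i k
    simp only [Matrix.mul_apply, P, Matrix.of_apply]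
    simp_rw [← MeasureTheory.integral_const_mul, ← MeasureTheory.integral_mul_const]
    rw [← MeasureTheory.integral_finsetSum _ fun p _ => hint _ (by have := hrc p j; have := hsc k l; fun_prop),
      ← MeasureTheory.integral_finsetSum _ fun p _ => hint _ (by have := hrc i j; have := hsc p l; fun_prop)]
    rw [← MeasureTheory.integral_mul_left_eq_self (μ := μ) (fun A => ∑ p, (r A : Matrix (Fin n) (Fin n) ℂ) i j *
      star ((s A : Matrix (Fin n) (Fin n) ℂ) p l) * (s B : Matrix (Fin n) (Fin n) ℂ) p k) B]
    congr 1
    funext A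
    have e1 : ∑ p, (r B : Matrix (Fin n) (Fin n) ℂ) i p * ((r A : Matrix (Fin n) (Fin n) ℂ) p j *
        star ((s A : Matrix (Fin n) (Fin n) ℂ) k l)) =
        (r (B * A) : Matrix (Fin n) (Fin n) ℂ) i j * star ((s A : Matrix (Fin n) (Fin n) ℂ) k l) := by
      rw [map_mul, Submonoid.coe_mul, Matrix.mul_apply, Finset.sum_mul]
      exact Finset.sum_congr rfl fun p _ => by ring
    have e2 : ∑ p, star ((s (B * A) : Matrix (Fin n) (Fin n) ℂ) p l) *
        (s B : Matrix (Fin n) (Fin n) ℂ) p k = star ((s A : Matrix (Fin n) (Fin n) ℂ) k l) := by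
      have : (s A : Matrix (Fin n) (Fin n) ℂ) = star (s B : Matrix (Fin n) (Fin n) ℂ) * s (B * A) := by
        rw [map_mul, Submonoid.coe_mul, ← mul_assoc, Matrix.UnitaryGroup.star_mul_self, one_mul]
      rw [this, Matrix.mul_apply, star_sum]
      refine Finset.sum_congr rfl fun p _ => ?_
      rw [star_mul', Matrix.star_apply, star_star, mul_comm]
    rw [e1, ← e2, Finset.mul_sum]
    exact Finset.sum_congr rfl fun p _ => by ring
  by_contra! hcon
  have hP0 : ∀ j l, P j l = 0 := fun j l => by
    by_contra hne
    obtain ⟨A, hA⟩ := hcon _ hne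
    exact hA (hP j l A)
  have h1 : ∫ A, ‖(r A : Matrix (Fin n) (Fin n) ℂ).trace‖ ^ 2 ∂μ = 0 := by
    rw [← Complex.ofReal_eq_zero, ← integral_complex_ofReal]
    have : ∀ A, ((‖(r A : Matrix (Fin n) (Fin n) ℂ).trace‖ ^ 2 : ℝ) : ℂ) = ∑ j, ∑ l,
        (r A : Matrix (Fin n) (Fin n) ℂ) j j * star ((s A : Matrix (Fin n) (Fin n) ℂ) l l) := by
      intro A
      rw [← Finset.sum_mul_sum, ← star_sum]
      change _ = (r A : Matrix (Fin n) (Fin n) ℂ).trace * star (s A : Matrix (Fin n) (Fin n) ℂ).trace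
      rw [← htr, Complex.star_def, Complex.mul_conj, Complex.normSq_eq_norm_sq]
    simp_rw [this]
    rw [MeasureTheory.integral_finsetSum _ fun j _ => hint _ (by have := hrc j j; have := hsc; fun_prop)]
    refine Finset.sum_eq_zero fun j _ => ?_
    rw [MeasureTheory.integral_finsetSum _ fun l _ => hint _ (by have := hrc j j; have := hsc l l; fun_prop)]
    exact Finset.sum_eq_zero fun l _ => congrFun (congrFun (hP0 j l) j) l
  have hcont : Continuous fun A => ‖(r A : Matrix (Fin n) (Fin n) ℂ).trace‖ ^ 2 := by
    have : Continuous fun A => (r A : Matrix (Fin n) (Fin n) ℂ).trace :=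
      continuous_finsetSum _ fun i _ => hrc i i
    fun_prop
  have h2 : 0 < ∫ A, ‖(r A : Matrix (Fin n) (Fin n) ℂ).trace‖ ^ 2 ∂μ :=
    hcont.integral_pos_of_hasCompactSupport_nonneg_nonzero (x := 1)
      (HasCompactSupport.of_compactSpace _) (fun A => by positivity) (by simp [NeZero.ne n])
  exact h2.ne' h1

open scoped ComplexOrder in
/-- If moreover `r` is onto, the intertwiner `P` is unitary up to scaling, because `P P*` commutes with
all unitary matrices. -/
theorem exists_conj_of_trace_eq {n : ℕ} [NeZero n] {r s : Un n →* Un n} (hr : Continuous r) (hs : Continuous s)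
    (hsurj : Function.Surjective r)
    (htr : ∀ A, (r A : Matrix (Fin n) (Fin n) ℂ).trace = (s A : Matrix (Fin n) (Fin n) ℂ).trace) :
    ∃ h : Un n, ∀ A, r A = h * s A * h⁻¹ := by
  obtain ⟨P, hP0, hP⟩ := exists_intertwiner hr hs htr
  have hstar : ∀ A, (s A : Matrix (Fin n) (Fin n) ℂ) * star P = star P * r A := by
    intro A
    have := congrArg star (hP A⁻¹)
    rw [star_mul, star_mul, map_inv, map_inv] at this
    simpa using this.symm
  obtain ⟨c, hc⟩ := exists_eq_smul_one_of_commute (P * star P) fun B => by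
    obtain ⟨A, rfl⟩ := hsurj B
    rw [← mul_assoc, hP, mul_assoc, hstar, mul_assoc]
  have hcpos : ∃ a : ℝ, 0 < a ∧ c = a := by
    let i : Fin n := 0
    have h1 : c = ((∑ j, ‖P i j‖ ^ 2 : ℝ) : ℂ) := by
      have := congrFun (congrFun hc i) i
      rw [Matrix.smul_apply, Matrix.one_apply_eq, smul_eq_mul, mul_one] at this
      rw [← this, Matrix.mul_apply, Complex.ofReal_sum]
      refine Finset.sum_congr rfl fun j _ => ?_
      rw [Matrix.star_apply, Complex.star_def, Complex.mul_conj, Complex.normSq_eq_norm_sq]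
    refine ⟨_, lt_of_le_of_ne (by positivity) fun h0 => hP0 ?_, h1⟩
    rw [← h0] at h1
    rw [h1, Complex.ofReal_zero, zero_smul] at hc
    exact Matrix.self_mul_conjTranspose_eq_zero.1 hc
  obtain ⟨a, ha, rfl⟩ := hcpos
  let h : Un n := ⟨((Real.sqrt a)⁻¹ : ℂ) • P, by
    rw [Matrix.mem_unitaryGroup_iff, star_smul, smul_mul_smul_comm, hc, smul_smul]
    have h2 : (Real.sqrt a : ℂ) * Real.sqrt a = a := by
      rw [← Complex.ofReal_mul, Real.mul_self_sqrt ha.le]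
    have h3 : (Real.sqrt a : ℂ) ≠ 0 := by
      rw [Complex.ofReal_ne_zero]; exact (Real.sqrt_pos.2 ha).ne'
    have h4 : star ((Real.sqrt a : ℂ)⁻¹) = (Real.sqrt a : ℂ)⁻¹ := by
      rw [Complex.star_def, map_inv₀, Complex.conj_ofReal]
    rw [h4, ← h2]
    field_simp
    simp⟩
  refine ⟨h, fun A => ?_⟩
  rw [eq_mul_inv_iff_mul_eq]
  apply Subtype.ext
  change (r A : Matrix (Fin n) (Fin n) ℂ) * (((Real.sqrt a)⁻¹ : ℂ) • P) = (((Real.sqrt a)⁻¹ : ℂ) • P) * s A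
  rw [mul_smul_comm, hP, smul_mul_assoc]

/-! ### Weights on the diagonal torus -/

/-- Inclusion of the groups of roots of unity gives divisibility; for `A = 0` the group is the whole
circle. -/
theorem Circle.dvd_of_forall_zpow_eq_one {A B : ℤ} (h : ∀ z : Circle, z ^ A = 1 → z ^ B = 1) :
    A ∣ B := by
  have hexp : ∀ (x : ℝ) (j : ℤ), Circle.exp x ^ j = Circle.exp (j * x) := fun x j => by
    rw [← zsmul_eq_mul, Circle.exp_zsmul]
  have key : ∀ x : ℝ, Circle.exp x = 1 ↔ ∃ j : ℤ, x = j * (2 * Real.pi) := fun x => by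
    rw [← Circle.exp_zero, Circle.exp_eq_exp]; simp
  have hpi := Real.pi_ne_zero
  rcases eq_or_ne A 0 with rfl | hA
  · have := h (Circle.exp 1) (zpow_zero _)
    rw [hexp, key] at this
    obtain ⟨j, hj⟩ := this
    rw [mul_one] at hj
    rw [zero_dvd_iff]
    by_contra hB
    have hj0 : j ≠ 0 := by
      rintro rfl
      simp at hj; exact hB hj
    refine (irrational_pi.ne_rat ((B : ℚ) / (2 * j))) ?_
    push_cast
    have : (j : ℝ) ≠ 0 := by exact_mod_cast hj0
    field_simp
    linarith
  · have hA' : (A : ℝ) ≠ 0 := by exact_mod_cast hA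
    have := h (Circle.exp (2 * Real.pi / A)) (by
      rw [hexp, key]; exact ⟨1, by field_simp; simp⟩)
    rw [hexp, key] at this
    obtain ⟨j, hj⟩ := this
    refine ⟨j, ?_⟩
    field_simp at hj
    exact_mod_cast hj

theorem Circle.zpow_right_injective {A B : ℤ} (h : ∀ z : Circle, z ^ A = z ^ B) : A = B := by
  have : (0 : ℤ) ∣ A - B := Circle.dvd_of_forall_zpow_eq_one fun z _ => by
    rw [zpow_sub, h, mul_inv_cancel]
  rw [zero_dvd_iff] at this
  omega

theorem Circle.exists_zpow_eq {N : ℤ} (hN : N ≠ 0) (z : Circle) : ∃ s : Circle, s ^ N = z := by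
  obtain ⟨x, rfl⟩ := Circle.exp_surjective z
  refine ⟨Circle.exp (x / N), ?_⟩
  have : (N : ℝ) ≠ 0 := by exact_mod_cast hN
  rw [← Circle.exp_zsmul, zsmul_eq_mul, mul_div_cancel₀ _ this]

theorem Un.exists_eq_diag {n : ℕ} (A : Un n) {d : Fin n → ℂ}
    (h : (A : Matrix (Fin n) (Fin n) ℂ) = Matrix.diagonal d) : ∃ t, A = Un.diag n t := by
  have hd : ∀ i, d i ∈ Metric.sphere (0 : ℂ) 1 := fun i => by
    have h1 := congrFun (congrFun (Matrix.mem_unitaryGroup_iff.1 A.2) i) i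
    rw [h, Matrix.star_eq_conjTranspose, Matrix.diagonal_conjTranspose,
      Matrix.diagonal_mul_diagonal, Matrix.diagonal_apply_eq, Matrix.one_apply_eq] at h1
    simp only [Pi.star_apply, Complex.star_def, Complex.mul_conj, Complex.normSq_eq_norm_sq] at h1
    rw [mem_sphere_zero_iff_norm]
    norm_cast at h1
    exact (pow_eq_one_iff_of_nonneg (norm_nonneg _) two_ne_zero).1 h1
  exact ⟨fun i => ⟨d i, hd i⟩, Subtype.ext h⟩

/-- The restriction of a continuous representation to the diagonal torus, diagonalized; the rows of `L`
are its weights. -/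
theorem exists_weights {n : ℕ} {r : Un n →* Un n} (hr : Continuous r) :
    ∃ (h : Un n) (L : Fin n → Fin n → ℤ), ∀ t : Fin n → Circle,
      h⁻¹ * r (Un.diag n t) * h = Un.diag n fun i => ∏ j, t j ^ L i j := by
  obtain ⟨h, hd⟩ := exists_unitary_forall_eq_diagonal (fun t => r (Un.diag n t)) fun s t => by
    change _ * _ = _ * _
    rw [← map_mul, ← map_mul, ← map_mul, ← map_mul, mul_comm]
  have hd' : ∀ t, ∃ c : Fin n → Circle, h⁻¹ * r (Un.diag n t) * h = Un.diag n c := fun t => by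
    obtain ⟨d, hd⟩ := hd t
    exact Un.exists_eq_diag _ hd
  choose c hc using hd'
  have hinj : Function.Injective (Un.diag n) := fun s t hst => by
    funext i
    have := congrFun (congrFun (congrArg Subtype.val hst) i) i
    simp only [Un.diag_coe, Matrix.diagonal_apply_eq] at this
    exact Circle.coe_injective this
  have hmul : ∀ s t, c (s * t) = c s * c t := fun s t => hinj <| by
    rw [map_mul, ← hc, ← hc, ← hc, map_mul, map_mul]
    group
  have hcont : ∀ i, Continuous fun t => c t i := fun i => by
    refine Topology.IsInducing.subtypeVal.continuous_iff.2 ?_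
    have := hr.comp (Un.continuous_diag n)
    refine ((Un.continuous_entry i i).comp
      ((continuous_const.mul this).mul continuous_const : Continuous fun t =>
        h⁻¹ * r (Un.diag n t) * h)).congr fun t => ?_
    change ((h⁻¹ * r (Un.diag n t) * h : Un n) : Matrix (Fin n) (Fin n) ℂ) i i = (c t i : ℂ)
    rw [hc, Un.diag_coe, Matrix.diagonal_apply_eq]
  let χ : Fin n → (Fin n → Circle) →* Circle := fun i => MonoidHom.mk' (fun t => c t i) fun s t => by
    rw [hmul]; rfl
  have hL : ∀ i j, ∃ k : ℤ, ∀ z, χ i (Pi.mulSingle j z) = z ^ k := fun i j =>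
    Circle.exists_zpow_of_continuous ((χ i).comp (MonoidHom.mulSingle (fun _ => Circle) j))
      ((hcont i).comp (continuous_mulSingle (A := fun _ => Circle) j))
  choose L hL using hL
  refine ⟨h, L, fun t => ?_⟩
  rw [hc]
  congr 1
  funext i
  change χ i t = _
  conv_lhs => rw [← Finset.univ_prod_mulSingle t]
  rw [map_prod]
  exact Finset.prod_congr rfl fun j _ => hL i j _

/-- The image of a permutation matrix carries weight spaces to weight spaces. -/
theorem weights_perm {n : ℕ} {r : Un n →* Un n} {h : Un n} {L : Fin n → Fin n → ℤ}
    (hL : ∀ t : Fin n → Circle,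
      h⁻¹ * r (Un.diag n t) * h = Un.diag n fun i => ∏ j, t j ^ L i j)
    (σ : Equiv.Perm (Fin n)) (i : Fin n) : ∃ j, ∀ l, L j l = L i (σ l) := by
  obtain ⟨Q, hQdef⟩ : ∃ Q, Q = h⁻¹ * r (Un.perm σ⁻¹) * h := ⟨_, rfl⟩
  have hQ : ∀ t, Q * Un.diag n (fun i => ∏ j, t j ^ L i j) =
      Un.diag n (fun i => ∏ j, (t ∘ ⇑(σ⁻¹)) j ^ L i j) * Q := fun t => by
    rw [← hL, ← hL]
    have := congrArg r (Un.perm_mul_diag σ⁻¹ t)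
    rw [map_mul, map_mul] at this
    rw [hQdef]
    calc _ = h⁻¹ * (r (Un.perm σ⁻¹) * r (Un.diag n t)) * h := by group
      _ = _ := by rw [this]; group
  have hrow : ∃ j, (Q : Matrix (Fin n) (Fin n) ℂ) i j ≠ 0 := by
    by_contra! h0
    have h1 := congrFun (congrFun (Matrix.mem_unitaryGroup_iff.1 Q.2) i) i
    rw [Matrix.mul_apply, Matrix.one_apply_eq] at h1
    simp [h0] at h1
  obtain ⟨j, hj⟩ := hrow
  refine ⟨j, fun l => Circle.zpow_right_injective fun z => ?_⟩
  have h1 := congrFun (congrFun (congrArg Subtype.val (hQ (Pi.mulSingle l z))) i) j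
  rw [Submonoid.coe_mul, Submonoid.coe_mul, Un.diag_coe, Un.diag_coe, Matrix.mul_diagonal,
    Matrix.diagonal_mul, mul_comm, mul_left_inj' hj, Circle.coe_inj] at h1
  rw [Finset.prod_eq_single l, Finset.prod_eq_single (σ l)] at h1
  · simpa using h1
  · intro b _ hb
    have : σ⁻¹ b ≠ l := by
      rintro rfl; simp at hb
    rw [Function.comp_apply, Pi.mulSingle_eq_of_ne this, one_zpow]
  · simp
  · intro b _ hb
    simp [hb]
  · simp

theorem card_le_of_forall_exists_row {n : ℕ} {L : Fin n → Fin n → ℤ} {α : Type*} [Fintype α]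
    (g : α → Fin n → ℤ) (hg : Function.Injective g) (h : ∀ a, ∃ j, L j = g a) :
    Fintype.card α ≤ n := by
  choose f hf using h
  have : Function.Injective f := fun a b hab => hg (by rw [← hf, ← hf, hab])
  simpa using Fintype.card_le_of_injective f this

/-- If all coordinate permutations of `x` are among the `n` rows of `L`, then `s (n - s) + 1 ≤ n` for
the cardinality `s` of each level set of `x`: the transpositions of an element of the level set with an
element outside give distinct vectors, all different from `x`. -/
theorem card_level_mul_add_one_le {n : ℕ} {L : Fin n → Fin n → ℤ} {x : Fin n → ℤ}
    (h : ∀ σ : Equiv.Perm (Fin n), ∃ j, L j = x ∘ σ) (c : ℤ) :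
    Fintype.card {l // x l = c} * Fintype.card {l // x l ≠ c} + 1 ≤ n := by
  rw [← Fintype.card_prod, ← Fintype.card_option]
  let g : Option ({l // x l = c} × {l // x l ≠ c}) → Fin n → ℤ := fun o =>
    o.elim x fun p => x ∘ Equiv.swap (p.1 : Fin n) (p.2 : Fin n)
  refine card_le_of_forall_exists_row (L := L) g ?_ ?_
  · have h1 : ∀ (p : {l // x l = c} × {l // x l ≠ c}) (l : Fin n),
        (x l = c ∧ (x ∘ Equiv.swap (p.1 : Fin n) (p.2 : Fin n)) l ≠ c ↔ l = p.1) ∧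
        (x l ≠ c ∧ (x ∘ Equiv.swap (p.1 : Fin n) (p.2 : Fin n)) l = c ↔ l = p.2) := by
      rintro ⟨⟨a, ha⟩, ⟨b, hb⟩⟩ l
      simp only [Function.comp_apply, Equiv.swap_apply_def]
      split_ifs with e1 e2 <;> grind
    rintro (_ | p) (_ | p') hpp
    · rfl
    · have hpp' : x = x ∘ Equiv.swap (p'.1 : Fin n) (p'.2 : Fin n) := hpp
      have := (h1 p' p'.1).1.2 rfl
      rw [← hpp'] at this
      exact absurd this.1 this.2
    · have hpp' : x ∘ Equiv.swap (p.1 : Fin n) (p.2 : Fin n) = x := hpp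
      have := (h1 p p.1).1.2 rfl
      rw [hpp'] at this
      exact absurd this.1 this.2
    · have hpp' : x ∘ Equiv.swap (p.1 : Fin n) (p.2 : Fin n) =
        x ∘ Equiv.swap (p'.1 : Fin n) (p'.2 : Fin n) := hpp
      have k1 := (h1 p p.1).1.2 rfl
      have k2 := (h1 p p.2).2.2 rfl
      rw [hpp'] at k1 k2
      have k1' := (h1 p' p.1).1.1 k1
      have k2' := (h1 p' p.2).2.1 k2
      rw [Prod.ext (Subtype.ext k1') (Subtype.ext k2')]
  · rintro (_ | p)
    · exact h 1
    · exact h _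

/-- A nonconstant vector with at most `n` coordinate permutations is constant except at one place. -/
theorem exists_eq_add_single {n : ℕ} {L : Fin n → Fin n → ℤ} {x : Fin n → ℤ}
    (h : ∀ σ : Equiv.Perm (Fin n), ∃ j, L j = x ∘ σ) (hx : ∃ i j, x i ≠ x j) :
    ∃ (a b : ℤ) (k : Fin n), b ≠ 0 ∧ ∀ l, x l = a + if l = k then b else 0 := by
  have hcard : ∀ c, Fintype.card {l // x l = c} + Fintype.card {l // x l ≠ c} = n := fun c => by
    have h1 := Fintype.card_subtype_compl (fun l => x l = c)
    have h2 := Fintype.card_subtype_le (fun l => x l = c)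
    rw [Fintype.card_fin] at h1 h2
    simp only [ne_eq]
    omega
  by_cases hex : ∃ c, Fintype.card {l // x l ≠ c} = 1
  · obtain ⟨c, hc⟩ := hex
    obtain ⟨⟨k, hk⟩, hk'⟩ := Fintype.card_eq_one_iff.1 hc
    refine ⟨c, x k - c, k, sub_ne_zero.2 hk, fun l => ?_⟩
    split_ifs with hl
    · rw [hl]; ring
    · by_contra hne
      rw [add_zero] at hne
      exact hl (congrArg Subtype.val (hk' ⟨l, hne⟩))
  · exfalso
    push Not at hex
    obtain ⟨i, j, hij⟩ := hx
    have hone : ∀ l, Fintype.card {l' // x l' = x l} = 1 := by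
      intro l
      -- For level sets of cardinality `s` and complement of cardinality `s' ≠ 1`, the bound
      -- `s s' + 1 ≤ s + s'` forces `s = 1`.
      have h1 := card_level_mul_add_one_le h (x l)
      have h2 := hcard (x l)
      have h3 := hex (x l)
      have h4 : 0 < Fintype.card {l' // x l' = x l} := Fintype.card_pos_iff.2 ⟨⟨l, rfl⟩⟩
      have h5 : 0 < Fintype.card {l' // x l' ≠ x l} := by
        refine Fintype.card_pos_iff.2 ?_
        by_cases hi : x i = x l
        · exact ⟨⟨j, fun hj => hij (hi.trans hj.symm)⟩⟩
        · exact ⟨⟨i, hi⟩⟩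
      generalize Fintype.card {l' // x l' = x l} = s at *
      generalize Fintype.card {l' // x l' ≠ x l} = s' at *
      by_contra hs
      obtain ⟨p, rfl⟩ : ∃ p, s = p + 2 := ⟨s - 2, by omega⟩
      obtain ⟨p', rfl⟩ : ∃ p, s' = p + 2 := ⟨s' - 2, by omega⟩
      nlinarith [Nat.zero_le (p * p')]
    have hinj : Function.Injective x := fun a b hab => by
      obtain ⟨w, hw⟩ := Fintype.card_eq_one_iff.1 (hone b)
      exact congrArg Subtype.val ((hw ⟨a, hab⟩).trans (hw ⟨b, rfl⟩).symm)
    -- With all coordinates distinct there are `n!` permuted vectors, so `n ≤ 2`.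
    have hfac : n.factorial ≤ n := by
      have := card_le_of_forall_exists_row (L := L) (α := Equiv.Perm (Fin n)) (fun σ => x ∘ σ)
        (fun σ τ hst => Equiv.ext fun l => hinj (congrFun hst l)) h
      rwa [Fintype.card_perm, Fintype.card_fin] at this
    have hn2 : n ≤ 2 := by
      by_contra! hn
      exact absurd hfac (not_le.2 (Nat.lt_factorial_self hn))
    have h1 := hcard (x i)
    rw [hone i] at h1
    have h3 := hex (x i)
    have h5 : 0 < Fintype.card {l' // x l' ≠ x i} := Fintype.card_pos_iff.2 ⟨⟨j, hij.symm⟩⟩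
    omega

/-- Linearly independent weights that are permuted by the coordinate permutations have the form
`a (1, …, 1) + b e_i`. -/
theorem exists_weights_form {n : ℕ} (hn : 2 ≤ n) {L : Fin n → Fin n → ℤ}
    (hperm : ∀ (σ : Equiv.Perm (Fin n)) (i : Fin n), ∃ j, ∀ l, L j l = L i (σ l))
    (hinj : ∀ v : Fin n → ℤ, (∀ i, ∑ j, L i j * v j = 0) → v = 0) :
    ∃ (a b : ℤ) (τ : Equiv.Perm (Fin n)), ∀ i l, L i l = a + if l = τ i then b else 0 := by
  have hrow : ∃ i l l', L i l ≠ L i l' := by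
    by_contra! hcon
    let i0 : Fin n := ⟨0, by omega⟩
    let i1 : Fin n := ⟨1, by omega⟩
    have h01 : i0 ≠ i1 := by simp [i0, i1]
    -- If all weights were constant, the cocharacter `e_0 - e_1` would be in their common kernel.
    have := hinj (Pi.single i0 1 - Pi.single i1 1) fun i => by
      simp [mul_sub, Finset.sum_sub_distrib, Pi.single_apply, hcon i i0 i1]
    have h2 := congrFun this i0
    simp [h01] at h2
  obtain ⟨i, l, l', hl⟩ := hrow
  have hx : ∀ σ : Equiv.Perm (Fin n), ∃ j, L j = L i ∘ σ := fun σ => by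
    obtain ⟨j, hj⟩ := hperm σ i
    exact ⟨j, funext hj⟩
  obtain ⟨a, b, k, hb, hk⟩ := exists_eq_add_single hx ⟨l, l', hl⟩
  have hall : ∀ p, ∃ j, ∀ l, L j l = a + if l = p then b else 0 := fun p => by
    obtain ⟨j, hj⟩ := hperm (Equiv.swap p k) i
    refine ⟨j, fun l => ?_⟩
    rw [hj, hk]
    congr 2
    exact propext ⟨fun h => (Equiv.swap p k).injective (h.trans (Equiv.swap_apply_left p k).symm),
      fun h => h ▸ Equiv.swap_apply_left p k⟩
  choose f hf using hall
  have hfinj : Function.Injective f := fun p p' hpp => by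
    have h1 := hf p p
    rw [hpp, hf p' p, if_pos rfl] at h1
    by_contra hne
    rw [if_neg hne] at h1
    exact hb (by linarith)
  let e := Equiv.ofBijective f (Finite.injective_iff_bijective.1 hfinj)
  refine ⟨a, b, e.symm, fun i l => ?_⟩
  rw [← hf]
  congr 1
  exact (e.apply_symm_apply i).symm

/-- A character is determined by its values on the diagonal torus. -/
theorem trace_eq_of_trace_diag_eq {n : ℕ} {r s : Un n →* Un n}
    (h : ∀ t, (r (Un.diag n t) : Matrix (Fin n) (Fin n) ℂ).trace =
      (s (Un.diag n t) : Matrix (Fin n) (Fin n) ℂ).trace) (A : Un n) :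
    (r A : Matrix (Fin n) (Fin n) ℂ).trace = (s A : Matrix (Fin n) (Fin n) ℂ).trace := by
  obtain ⟨g, hg⟩ := exists_unitary_forall_eq_diagonal (fun _ : Unit => A) fun _ _ => Commute.refl _
  obtain ⟨d, hd⟩ := hg ()
  obtain ⟨t, ht⟩ := Un.exists_eq_diag _ hd
  have hconj : ∀ (ρ : Un n →* Un n), (ρ A : Matrix (Fin n) (Fin n) ℂ).trace =
      (ρ (g⁻¹ * A * g) : Matrix (Fin n) (Fin n) ℂ).trace := fun ρ => by
    have e : ((g⁻¹ * A * g : Un n)) = g⁻¹ * (A * g) := mul_assoc _ _ _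
    rw [e, map_mul, Submonoid.coe_mul, Matrix.trace_mul_comm, ← Submonoid.coe_mul, ← map_mul,
      mul_assoc, mul_inv_cancel, mul_one]
  rw [hconj r, hconj s, ht, h]

/-! ### Classification of the isomorphisms `U_n/ℤ_m → U_n` and conclusion -/

theorem Un.diag_mem_Zm_iff {n m : ℕ} [NeZero m] [NeZero n] (t : Fin n → Circle) :
    Un.diag n t ∈ Zm n m ↔ ∃ s : Circle, s ^ m = 1 ∧ t = fun _ => s := by
  constructor
  · rintro ⟨σ, hσ, h⟩
    have ht : ∀ i, (t i : ℂ) = σ := fun i => by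
      have := congrFun (congrFun h i) i
      rwa [Un.diag_coe, Matrix.diagonal_apply_eq, Matrix.smul_apply, Matrix.one_apply_eq,
        smul_eq_mul, mul_one] at this
    refine ⟨t 0, Circle.coe_injective ?_, funext fun i => Circle.coe_injective ?_⟩
    · rw [Circle.coe_pow, ht, hσ, Circle.coe_one]
    · rw [ht, ht]
  · rintro ⟨s, hs, rfl⟩
    refine ⟨s, by rw [← Circle.coe_pow, hs, Circle.coe_one], ?_⟩
    rw [Un.diag_coe, ← Matrix.diagonal_one, ← Matrix.diagonal_smul]
    congr 1
    funext i
    simp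

theorem conjUn_diag {n : ℕ} (t : Fin n → Circle) : conjUn n (Un.diag n t) = Un.diag n t⁻¹ := by
  apply Subtype.ext
  change (Matrix.diagonal fun i => (t i : ℂ)).map star = Matrix.diagonal fun i => ((t⁻¹ i : Circle) : ℂ)
  rw [Matrix.diagonal_map (star_zero _)]
  congr 1
  funext i
  exact (Circle.coe_inv_eq_conj _).symm

theorem detTwist_diag {n : ℕ} (k : ℤ) (t : Fin n → Circle) :
    detTwist n k (Un.diag n t) = Un.diag n fun i => (∏ j, t j) ^ k * t i := by
  apply Subtype.ext
  have hprod : ∏ i, (t i : ℂ) = ((∏ i, t i : Circle) : ℂ) := (map_prod Circle.coeHom _ _).symm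
  rw [detTwist_coe, Un.diag_coe, Un.diag_coe, Matrix.det_diagonal, hprod, ← Matrix.diagonal_smul]
  congr 1

theorem continuous_detTwist (n : ℕ) (k : ℤ) : Continuous (detTwist n k) := by
  have hc : Continuous fun A : Un n => (A : Matrix (Fin n) (Fin n) ℂ).det :=
    continuous_subtype_val.matrix_det
  exact Continuous.subtype_mk
    ((hc.zpow₀ k fun A => .inl (Matrix.UnitaryGroup.det_isUnit A).ne_zero).smul
      continuous_subtype_val) _

theorem continuous_conjUn (n : ℕ) : Continuous (conjUn n) :=
  Continuous.subtype_mk (continuous_subtype_val.matrix_map continuous_star) _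

/-- The numbers `a`, `b` when the kernel of the weights `a (1, …, 1) + b e_i` consists of the scalar
`m`-th roots of unity. -/
theorem weights_of_ker_eq_Zm {n m : ℕ} (hn : 2 ≤ n) [NeZero n] [NeZero m] {a b : ℤ}
    (hker : ∀ t : Fin n → Circle, (∀ i, (∏ j, t j) ^ a * t i ^ b = 1) ↔
      ∃ s : Circle, s ^ m = 1 ∧ t = fun _ => s) :
    (b = 1 ∨ b = -1) ∧ |(n : ℤ) * a + b| = m := by
  have hscal : ∀ s : Circle, s ^ ((n : ℤ) * a + b) = 1 ↔ s ^ (m : ℤ) = 1 := by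
    intro s
    have := hker fun _ => s
    simp only [Finset.prod_const, Finset.card_univ, Fintype.card_fin, forall_const] at this
    rw [zpow_natCast, zpow_add, zpow_mul, zpow_natCast, this]
    constructor
    · rintro ⟨s', hs', h⟩
      rwa [congrFun h 0]
    · exact fun h => ⟨s, h, rfl⟩
  have h1 := Circle.dvd_of_forall_zpow_eq_one fun z => (hscal z).1
  have h2 := Circle.dvd_of_forall_zpow_eq_one fun z => (hscal z).2
  have habs : |(n : ℤ) * a + b| = m := by
    rw [Int.abs_eq_natAbs, Nat.cast_inj]
    simpa using Int.natAbs_eq_of_dvd_dvd h1 h2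
  have hN : (n : ℤ) * a + b ≠ 0 := by
    intro h
    rw [h, abs_zero] at habs
    exact NeZero.ne m (by exact_mod_cast habs.symm)
  refine ⟨?_, habs⟩
  have hb : b ∣ 1 := Circle.dvd_of_forall_zpow_eq_one fun ζ hζ => by
    -- For `ζ ^ b = 1`, the matrix `diag(ζ s, s, …, s)` is in the kernel by the choice of `s`, hence scalar.
    obtain ⟨s, hs⟩ := Circle.exists_zpow_eq hN (ζ ^ (-a))
    let t : Fin n → Circle := Function.update (fun _ => s) 0 (ζ * s)
    have hprod : ∏ j, t j = ζ * s ^ n := by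
      have : t = Pi.mulSingle 0 ζ * fun _ => s := by
        funext i
        by_cases hi : i = 0
        · subst hi; simp [t]
        · simp [t, hi]
      rw [this]
      simp [Finset.prod_mul_distrib]
    have ht : ∀ i, (∏ j, t j) ^ a * t i ^ b = 1 := by
      have hs' : ζ ^ a * (s ^ n) ^ a * s ^ b = 1 := by
        rw [← zpow_natCast s n, ← zpow_mul, mul_assoc, ← zpow_add, hs, ← zpow_add, add_neg_cancel,
          zpow_zero]
      intro i
      rw [hprod, mul_zpow]
      by_cases hi : i = 0
      · subst hi
        simp only [t, Function.update_self]
        rw [mul_zpow, hζ, one_mul, hs']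
      · simp only [t, Function.update_of_ne hi]
        exact hs'
    obtain ⟨s', -, h⟩ := (hker t).1 ht
    let i1 : Fin n := ⟨1, by omega⟩
    have h01 : i1 ≠ 0 := by simp [i1, Fin.ext_iff]
    have e0 := congrFun h 0
    have e1 := congrFun h i1
    simp only [t, Function.update_self, Function.update_of_ne h01] at e0 e1
    rw [zpow_one]
    exact mul_eq_right.1 (e0.trans e1.symm)
  exact Int.isUnit_iff.1 (isUnit_of_dvd_one hb)

theorem prod_zpow_eq_zpow_sum {ι G : Type*} [CommGroup G] (s : Finset ι) (f : ι → ℤ) (z : G) :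
    ∏ i ∈ s, z ^ f i = z ^ ∑ i ∈ s, f i := by
  classical
  induction s using Finset.induction_on with
  | empty => simp
  | insert i s hi ih => rw [Finset.prod_insert hi, Finset.sum_insert hi, ih, zpow_add]

/-- A continuous surjective representation with kernel `ℤ_m` is conjugate to `A ↦ (det A)^k A` or to its
composition with complex conjugation. -/
theorem exists_conj_detTwist {n m : ℕ} (hn : 2 ≤ n) [NeZero n] [NeZero m] {k : ℤ}
    (hm : (m : ℤ) = |(n : ℤ) * k + 1|) {r : Un n →* Un n} (hr : Continuous r)
    (hsurj : Function.Surjective r) (hker : r.ker = Zm n m) :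
    ∃ h : Un n, (∀ A, r A = h * detTwist n k A * h⁻¹) ∨
      (∀ A, r A = h * detTwist n k (conjUn n A) * h⁻¹) := by
  obtain ⟨g, L, hL⟩ := exists_weights hr
  have hkerL : ∀ t : Fin n → Circle, (∀ i, ∏ j, t j ^ L i j = 1) ↔
      ∃ s : Circle, s ^ m = 1 ∧ t = fun _ => s := fun t => by
    rw [← Un.diag_mem_Zm_iff, ← hker, MonoidHom.mem_ker]
    have h1 : r (Un.diag n t) = 1 ↔ g⁻¹ * r (Un.diag n t) * g = 1 := by
      rw [mul_assoc, inv_mul_eq_one, eq_comm (a := g), mul_eq_right]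
    rw [h1, hL]
    constructor
    · intro h
      rw [show (fun i => ∏ j, t j ^ L i j) = 1 from funext h, map_one]
    · intro h i
      have := congrFun (congrFun (congrArg Subtype.val h) i) i
      rw [Un.diag_coe, Matrix.diagonal_apply_eq] at this
      apply Circle.coe_injective
      simpa using this
  obtain ⟨a, b, τ, hτ⟩ := exists_weights_form hn (weights_perm hL) fun v hv => by
    funext j
    have : (0 : ℤ) ∣ v j * m := Circle.dvd_of_forall_zpow_eq_one fun z _ => by
      obtain ⟨s, hs, h⟩ := (hkerL fun j => z ^ v j).1 fun i => by
        simp_rw [← zpow_mul, mul_comm (v _)]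
        rw [prod_zpow_eq_zpow_sum, hv i, zpow_zero]
      rw [zpow_mul, zpow_natCast, congrFun h j, hs]
    rw [zero_dvd_iff] at this
    exact (mul_eq_zero.1 this).resolve_right (by exact_mod_cast NeZero.ne m)
  have hprod : ∀ (t : Fin n → Circle) i, ∏ j, t j ^ L i j = (∏ j, t j) ^ a * t (τ i) ^ b := by
    intro t i
    simp_rw [hτ, zpow_add, Finset.prod_mul_distrib, Finset.prod_zpow]
    congr 1
    rw [Finset.prod_eq_single (τ i)] <;> simp +contextual
  simp_rw [hprod] at hkerL hL
  obtain ⟨hb, hab⟩ := weights_of_ker_eq_Zm (m := m) hn (a := a) (b := b) fun t => by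
    rw [← hkerL t]
    exact ⟨fun h i => h (τ i), fun h i => by simpa using h (τ.symm i)⟩
  have htr : ∀ t, (r (Un.diag n t) : Matrix (Fin n) (Fin n) ℂ).trace =
      ((∏ j, t j) ^ a : Circle) * ∑ i, ((t i ^ b : Circle) : ℂ) := by
    intro t
    have h1 : (r (Un.diag n t) : Matrix (Fin n) (Fin n) ℂ).trace =
        ((g⁻¹ * r (Un.diag n t) * g : Un n) : Matrix (Fin n) (Fin n) ℂ).trace := by
      rw [mul_assoc, Submonoid.coe_mul, Matrix.trace_mul_comm, ← Submonoid.coe_mul, mul_assoc,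
        mul_inv_cancel, mul_one]
    rw [h1, hL, Un.diag_coe, Matrix.trace_diagonal, Finset.mul_sum]
    exact (Equiv.sum_comp τ (fun i => (((∏ j, t j) ^ a * t i ^ b : Circle) : ℂ))).trans (by simp)
  have htrT : ∀ t, (detTwist n k (Un.diag n t) : Matrix (Fin n) (Fin n) ℂ).trace =
      ((∏ j, t j) ^ k : Circle) * ∑ i, (t i : ℂ) := by
    intro t
    rw [detTwist_diag, Un.diag_coe, Matrix.trace_diagonal, Finset.mul_sum]
    simp
  have htrC : ∀ t, (detTwist n k (conjUn n (Un.diag n t)) : Matrix (Fin n) (Fin n) ℂ).trace =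
      ((∏ j, t j) ^ (-k) : Circle) * ∑ i, ((t i ^ (-1 : ℤ) : Circle) : ℂ) := by
    intro t
    rw [conjUn_diag, htrT]
    simp
  -- For `n = 2` the standard representation and its conjugate differ by the determinant, which accounts
  -- for the solutions of `|n a + b| = |n k + 1|` other than `a = ±k`.
  have htwo : n = 2 → ∀ t : Fin n → Circle,
      ∑ i, (t i : ℂ) = ((∏ j, t j : Circle) : ℂ) * ∑ i, (t i : ℂ)⁻¹ := by
    rintro rfl t
    simp only [Fin.prod_univ_two, Fin.sum_univ_two, Circle.coe_mul]
    have h0 := Circle.coe_ne_zero (t 0)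
    have h1 := Circle.coe_ne_zero (t 1)
    field_simp
    ring
  have hcases : (∀ A, (r A : Matrix (Fin n) (Fin n) ℂ).trace =
      (detTwist n k A : Matrix (Fin n) (Fin n) ℂ).trace) ∨
      (∀ A, (r A : Matrix (Fin n) (Fin n) ℂ).trace =
      (((detTwist n k).comp (conjUn n)) A : Matrix (Fin n) (Fin n) ℂ).trace) := by
    rw [hm, abs_eq_abs] at hab
    have hn0 : (n : ℤ) ≠ 0 := by exact_mod_cast NeZero.ne n
    rcases hb with rfl | rfl <;> rcases hab with hab | hab
    · left
      have : a = k := mul_left_cancel₀ hn0 (by linarith)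
      subst this
      refine fun A => trace_eq_of_trace_diag_eq (fun t => ?_) A
      rw [htr, htrT]
      simp
    · right
      have h2 : (n : ℤ) * (-a - k) = 2 := by linarith
      have hn2 : n = 2 := by
        have : (n : ℤ) ∣ 2 := ⟨_, h2.symm⟩
        have := Nat.le_of_dvd two_pos (by exact_mod_cast this)
        omega
      have ha : a = -k - 1 := by
        rw [hn2] at h2; push_cast at h2; omega
      refine fun A => trace_eq_of_trace_diag_eq (fun t => ?_) A
      rw [htr, MonoidHom.comp_apply, htrC, ha]
      simp only [zpow_one, zpow_neg_one, Circle.coe_zpow, Circle.coe_inv]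
      rw [htwo hn2, ← mul_assoc, ← zpow_add_one₀ (Circle.coe_ne_zero _), sub_add_cancel]
    · left
      have h2 : (n : ℤ) * (a - k) = 2 := by linarith
      have hn2 : n = 2 := by
        have : (n : ℤ) ∣ 2 := ⟨_, h2.symm⟩
        have := Nat.le_of_dvd two_pos (by exact_mod_cast this)
        omega
      have ha : a = k + 1 := by
        rw [hn2] at h2; push_cast at h2; omega
      refine fun A => trace_eq_of_trace_diag_eq (fun t => ?_) A
      rw [htr, htrT, ha]
      simp only [zpow_neg_one, Circle.coe_zpow, Circle.coe_inv]
      rw [htwo hn2, ← mul_assoc, zpow_add_one₀ (Circle.coe_ne_zero _)]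
    · right
      have : a = -k := mul_left_cancel₀ hn0 (by linarith)
      subst this
      refine fun A => trace_eq_of_trace_diag_eq (fun t => ?_) A
      rw [htr, MonoidHom.comp_apply, htrC]
  rcases hcases with h | h
  · obtain ⟨u, hu⟩ := exists_conj_of_trace_eq hr (continuous_detTwist n k) hsurj h
    exact ⟨u, .inl hu⟩
  · obtain ⟨u, hu⟩ := exists_conj_of_trace_eq hr
      (s := (detTwist n k).comp (conjUn n)) ((continuous_detTwist n k).comp (continuous_conjUn n)) hsurj h
    exact ⟨u, .inr hu⟩

theorem conjQuot_conjQuot {n m : ℕ} (g : Un n ⧸ Zm n m) :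
    conjQuot n m (conjQuot n m g) = g := by
  induction g using QuotientGroup.induction_on with
  | H A => exact congrArg (QuotientGroup.mk (s := Zm n m)) (conjUn_conjUn A)

theorem proposition2p4 (n m : ℕ) [NeZero n] [NeZero m] (hn : 2 ≤ n)
    (k : ℤ) (hm : (m : ℤ) = |(n : ℤ) * k + 1|)
    {M : Type*} [TopologicalSpace M] [T2Space M] [ChartedSpace (Cn n) M]
    [IsManifold 𝓘(ℂ, Cn n) ω M]
    [MulAction (Un n) M] [ContinuousSMul (Un n) M] [FaithfulSMul (Un n) M]
    (hhol : ∀ g : Un n, ContMDiff 𝓘(ℂ, Cn n) 𝓘(ℂ, Cn n) ω (fun x : M => g • x))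
    (p : M) (hreal : IsRealHypersurface n (MulAction.orbit (Un n) p))
    (hiso : IsLensHomogeneous n m (MulAction.orbit (Un n) p)) :
    ∃ F : Lens n m → M, IsCRDiffeoOnto F (MulAction.orbit (Un n) p) ∧
      ((∀ (g : Un n ⧸ Zm n m) (q : Lens n m), F (g • q) = lensPhi n m k hm g • F q) ∨
        (∀ (g : Un n ⧸ Zm n m) (q : Lens n m),
          F (g • q) = lensPhi n m k hm (conjQuot n m g) • F q)) := by
  obtain ⟨ψ, f, hf, hψ⟩ := hiso
  let r : Un n →* Un n := (ψ : Un n ⧸ Zm n m →* Un n).comp (QuotientGroup.mk' (Zm n m))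
  have hr : Continuous r := ψ.continuous.comp QuotientGroup.continuous_mk
  have hsurj : Function.Surjective r := ψ.surjective.comp (QuotientGroup.mk'_surjective _)
  have hker : r.ker = Zm n m := by
    ext A
    rw [MonoidHom.mem_ker]
    change ψ (A : Un n ⧸ Zm n m) = 1 ↔ _
    rw [EmbeddingLike.map_eq_one_iff, QuotientGroup.eq_one_iff]
  obtain ⟨h, hconj⟩ := exists_conj_detTwist hn hm hr hsurj hker
  let F : Lens n m → M := fun x => h⁻¹ • f x
  have hF : IsDiffeoOnto F (MulAction.orbit (Un n) p) := by
    obtain ⟨h1, h2, G, hG, hGf⟩ := hf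
    refine ⟨(hhol h⁻¹).restrictScalars_real.comp h1, ?_, fun y => G (h • y),
      hG.comp (hhol h).restrictScalars_real.contMDiffOn fun y hy =>
        MulAction.mem_orbit_of_mem_orbit h hy, fun x => ?_⟩
    · change Set.range ((fun y => h⁻¹ • y) ∘ f) = _
      rw [Set.range_comp, h2]
      exact MulAction.smul_orbit h⁻¹ p
    · simp only [F, smul_inv_smul, hGf]
  have he : HolomorphicallyEquivariant F := by
    intro A
    refine ⟨fun y => (h⁻¹ * r A * h) • y, hhol _, fun q => ?_⟩
    simp only [F]
    rw [← lensAction_mk, hψ, smul_smul, smul_smul, mul_assoc, mul_assoc, mul_inv_cancel, mul_one]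
    rfl
  have hF' : (∀ (g : Un n ⧸ Zm n m) (q : Lens n m), F (g • q) = lensPhi n m k hm g • F q) ∨
        (∀ (g : Un n ⧸ Zm n m) (q : Lens n m),
          F (g • q) = lensPhi n m k hm (conjQuot n m g) • F q) := by
    have key : ∀ (A B : Un n), r A = h * B * h⁻¹ → ∀ q : Lens n m,
        F ((A : Un n ⧸ Zm n m) • q) = B • F q := fun A B hAB q => by
      simp only [F]
      rw [hψ]
      change h⁻¹ • r A • f q = _
      rw [hAB, smul_smul, smul_smul]
      congr 1
      group
    refine hconj.imp (fun hA g q => ?_) (fun hA g q => ?_)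
    all_goals
      induction g using QuotientGroup.induction_on with
      | H A => exact key A _ (hA A) q
  rcases isCRDiffeoOnto_or_comp_conj hF he with hCR | hCR
  · exact ⟨F, hCR, hF'⟩
  · refine ⟨F ∘ Lens.conj, hCR, hF'.symm.imp (fun hA g q => ?_) (fun hA g q => ?_)⟩
    all_goals simp only [Function.comp_apply, Lens.conj_smul, hA, conjQuot_conjQuot]

end
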